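/- Let $\mathbb M$ be a smooth Hausdorff manifold of dimension $d+\mathfrak h$ with a bracket generating subbundle $\mathcal H\subset T\mathbb M$ of rank $d$, a smooth fiberwise inner product $g_{\mathcal H}$ on $\mathcal H$, and transverse symmetries: an $\mathfrak h$-dimensional Lie algebra $\mathcal V$ of smooth vector fields $Z$ such that $[Z,X]$ is horizontal for every horizontal field $X$ and $\mathcal L_Zg_{\mathcal H}=0$, with $T_x\mathbb M=\mathcal H(x)\oplus\mathcal V(x)$ for all $x$. Fix an inner product $g_{\mathcal V}$ on $\mathcal V$ and $\varepsilon>0$. A local adapted frame around a point consists of a smooth local $g_{\mathcal H}$-orthonormal frame $X_1,\dots,X_d$ of $\mathcal H$ and a $g_{\mathcal V}$-orthonormal basis $Z_1,\dots,Z_{\mathfrak h}$ of $\mathcal V$; let $\theta_i,\nu_m$ be the dual coframe, and let $\langle\cdot,\cdot\rangle_\varepsilon$ be the metric on one-forms for which $\theta_i,\varepsilon^{-1/2}\nu_m$ are orthonormal. Let $\nabla$ be the canonical connection: it is metric for all $g_{\mathcal H}\oplus\frac1\varepsilon g_{\mathcal V}$, preserves $\mathcal H$, satisfies $\nabla Z=0$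 for $Z\in\mathcal V$, and its torsion $T(X,Y)=\nabla_XY-\nabla_YX-[X,Y]$ is vertical for $X,Y$ horizontal and zero for $X$ horizontal, $Y\in\mathcal V$. In a local adapted frame with $[X_i,X_j]=\sum_k\omega_{ij}^kX_k+\sum_m\gamma_{ij}^mZ_m$ and $[X_i,Z_m]=\sum_k\delta_{im}^kX_k$ it is given by $\nabla_{X_i}X_j=\sum_k\frac12(\omega_{ij}^k+\omega_{ki}^j+\omega_{kj}^i)X_k$, $\nabla_{Z_m}X_i=-\sum_k\delta_{im}^kX_k$, $\nabla Z_m=0$. Define, on functions, $L=\sum_i\big(X_i^2-\nabla_{X_i}X_i\big)$ and, on one-forms, $L=\sum_i\big(\nabla_{X_i}\nabla_{X_i}-\nabla_{\nabla_{X_i}X_i}\big)$. Let $\mathfrak{Ric}_{\mathcal H}$ be the horizontal fiberwise linear map on one-forms with $\langle\mathfrak{Ric}_{\mathcal H}(df),dg\rangle_\varepsilon=\mathbf{Ricci}(\nabla_{\mathcal H}f,\nabla_{\mathcal H}g)$, where $\mathbf{Ricci}$ is the Ricci curvature of $\nabla$ and $\nabla_{\mathcal H}f=\sum_i(X_if)X_i$;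 for $\eta=\sum_if_i\theta_i+\sum_mg_m\nu_m$ let $\mathfrak J(\eta)=\sum_{i,j,m}\gamma_{ij}^m(X_jg_m)\theta_i$; and put $\square_\infty=L+2\mathfrak J-\mathfrak{Ric}_{\mathcal H}$. Interpret the horizontal torsion as the fiberwise linear map $T$ from two-forms to one-forms with $T(\theta_i\wedge\theta_j)=\sum_mg_{\mathcal V}(T(X_i,X_j),Z_m)\,\nu_m=-\sum_m\gamma_{ij}^m\nu_m$ and $T(\theta_i\wedge\nu_m)=T(\nu_\ell\wedge\nu_m)=0$. Then for every fiberwise linear map $\Lambda$ from two-forms to one-forms and every $x\in\mathbb M$, $$\inf_{\eta,\ \|\eta(x)\|_\varepsilon=1}\Big(\tfrac12(L\|\eta\|_\varepsilon^2)(x)-\big\langle(\square_\infty+\Lambda\circ d)\eta(x),\eta(x)\big\rangle_\varepsilon\Big)\le\inf_{\eta,\ \|\eta(x)\|_\varepsilon=1}\Big(\tfrac12(L\|\eta\|_\varepsilon^2)(x)-\big\langle\big(\square_\infty-\tfrac1\varepsilon T\circ d\big)\eta(x),\eta(x)\big\rangle_\varepsilon\Big),$$ where both infima run over the smooth one-forms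 $\eta$ on $\mathbb M$ with $\|\eta(x)\|_\varepsilon=1$ and are taken in $[-\infty,+\infty]$. -/

import Mathlib

open Set Filter Topology Module
open scoped Manifold ContDiff

noncomputable section

section Basics

variable (E : Type*) [NormedAddCommGroup E] [NormedSpace ℝ E]
  (M : Type*) [TopologicalSpace M] [ChartedSpace E M]

/-- Vector fields on `M` (no regularity). -/
abbrev VField : Type _ := (x : M) → TangentSpace 𝓘(ℝ, E) x

/-- One-forms on `M` (no regularity). -/
abbrev OneForm : Type _ := (x : M) → (TangentSpace 𝓘(ℝ, E) x →L[ℝ] ℝ)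

/-- The space of two-forms at a point. -/
abbrev TwoFormAt (x : M) : Type _ := TangentSpace 𝓘(ℝ, E) x [⋀^Fin 2]→L[ℝ] ℝ

variable {E M}

/-- The derivative `X f` of a function along a vector field. -/
def VField.deriv (X : VField E M) (f : M → ℝ) (x : M) : ℝ :=
  (mfderiv 𝓘(ℝ, E) 𝓘(ℝ, ℝ) f x : TangentSpace 𝓘(ℝ, E) x →L[ℝ] ℝ) (X x)

/-- The differential of a function, as a one-form. -/
def OneForm.ofFun (f : M → ℝ) : OneForm E M := fun x =>
  (mfderiv 𝓘(ℝ, E) 𝓘(ℝ, ℝ) f x : TangentSpace 𝓘(ℝ, E) x →L[ℝ] ℝ)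

/-- The exterior derivative of a one-form at a point, computed in the preferred chart there.
With this normalisation `dη(X, Y) = X(η(Y)) - Y(η(X)) - η([X, Y])`. -/
def OneForm.extDerivAt (η : OneForm E M) (x : M) : TwoFormAt E M x :=
  (extDeriv (fun z : E => ContinuousAlternatingMap.ofSubsingleton ℝ E ℝ (0 : Fin 1)
      ((η ((extChartAt 𝓘(ℝ, E) x).symm z)).comp
        (mfderiv 𝓘(ℝ, E) 𝓘(ℝ, E) (extChartAt 𝓘(ℝ, E) x).symm z)))
    (extChartAt 𝓘(ℝ, E) x x)).compContinuousLinearMap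
      (mfderiv 𝓘(ℝ, E) 𝓘(ℝ, E) (extChartAt 𝓘(ℝ, E) x) x :
        TangentSpace 𝓘(ℝ, E) x →L[ℝ] E)

variable [IsManifold 𝓘(ℝ, E) ∞ M]

/-- A vector field is smooth on a set. -/
def VField.SmoothOn (X : VField E M) (U : Set M) : Prop :=
  ContMDiffOn 𝓘(ℝ, E) (𝓘(ℝ, E).prod 𝓘(ℝ, E)) ∞
    (fun x => (Bundle.TotalSpace.mk' E x (X x) : TangentBundle 𝓘(ℝ, E) M)) U

/-- A one-form is smooth as a section of the cotangent bundle. -/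
def OneForm.Smooth (η : OneForm E M) : Prop :=
  ContMDiff 𝓘(ℝ, E) (𝓘(ℝ, E).prod 𝓘(ℝ, E →L[ℝ] ℝ)) ∞
    (fun x => Bundle.TotalSpace.mk' (E →L[ℝ] ℝ)
      (E := fun x : M => TangentSpace 𝓘(ℝ, E) x →L[ℝ] Bundle.Trivial M ℝ x) x (η x))

end Basics

section SubRiemannian

variable (E : Type*) [NormedAddCommGroup E] [NormedSpace ℝ E]
  (M : Type*) [TopologicalSpace M] [ChartedSpace E M] [IsManifold 𝓘(ℝ, E) ∞ M]

variable {E M} in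
/-- The Lie algebra of vector fields generated by the smooth sections of a distribution. -/
inductive InLieHull (H : (x : M) → Submodule ℝ (TangentSpace 𝓘(ℝ, E) x)) : VField E M → Prop
  | of (X : VField E M) (hX : X.SmoothOn univ) (hH : ∀ x, X x ∈ H x) : InLieHull H X
  | add (X Y : VField E M) : InLieHull H X → InLieHull H Y → InLieHull H (X + Y)
  | smul (c : ℝ) (X : VField E M) : InLieHull H X → InLieHull H (c • X)
  | bracket (X Y : VField E M) : InLieHull H X → InLieHull H Y →
      InLieHull H (VectorField.mlieBracket 𝓘(ℝ, E) X Y)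

/-- A sub-Riemannian structure: a smooth bracket generating distribution `H` of rank `d` with a
smooth fibrewise inner product. -/
structure SubRiemannian (d : ℕ) where
  H : (x : M) → Submodule ℝ (TangentSpace 𝓘(ℝ, E) x)
  finrank_H : ∀ x, finrank ℝ (H x) = d
  gH : (x : M) → LinearMap.BilinForm ℝ (H x)
  gH_symm : ∀ x u v, gH x u v = gH x v u
  gH_pos : ∀ x u, u ≠ 0 → 0 < gH x u u
  /-- Smoothness of `H` and of `gH`: there are smooth local orthonormal frames. -/
  exists_frame : ∀ x : M, ∃ U : Set M, IsOpen U ∧ x ∈ U ∧ ∃ X : Fin d → VField E M,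
    (∀ i, (X i).SmoothOn U) ∧ ∀ y ∈ U, ∃ hX : ∀ i, X i y ∈ H y,
      ∀ i j, gH y ⟨X i y, hX i⟩ ⟨X j y, hX j⟩ = if i = j then 1 else 0
  bracket_generating : ∀ x : M,
    Submodule.span ℝ {u : TangentSpace 𝓘(ℝ, E) x | ∃ X, InLieHull H X ∧ X x = u} = ⊤

/-- A sub-Riemannian structure with transverse symmetries: an `h`-dimensional Lie algebra `V` of
sub-Riemannian Killing fields which is pointwise a complement of `H`, together with the choice of
an inner product `gV` on `V`. -/
structure TransverseSymmetries (d h : ℕ) extends SubRiemannian E M d where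
  finrank_model : finrank ℝ E = d + h
  V : Submodule ℝ (VField E M)
  finite_V : FiniteDimensional ℝ V
  finrank_V : finrank ℝ V = h
  smooth_V : ∀ Z ∈ V, Z.SmoothOn univ
  bracket_V : ∀ Z ∈ V, ∀ W ∈ V, VectorField.mlieBracket 𝓘(ℝ, E) Z W ∈ V
  /-- The flow of `Z` infinitesimally preserves `H`. -/
  killing_H : ∀ Z ∈ V, ∀ X : VField E M, X.SmoothOn univ → (∀ x, X x ∈ H x) →
    ∀ x, VectorField.mlieBracket 𝓘(ℝ, E) Z X x ∈ H x
  /-- The Lie derivative of `gH` along `Z` vanishes. -/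
  killing_gH : ∀ (Z : VField E M) (hZ : Z ∈ V) (X Y : VField E M)
    (sX : X.SmoothOn univ) (hX : ∀ x, X x ∈ H x) (sY : Y.SmoothOn univ) (hY : ∀ x, Y x ∈ H x)
    (x : M), Z.deriv (fun y => gH y ⟨X y, hX y⟩ ⟨Y y, hY y⟩) x =
      gH x ⟨VectorField.mlieBracket 𝓘(ℝ, E) Z X x, killing_H Z hZ X sX hX x⟩ ⟨Y x, hY x⟩ +
      gH x ⟨X x, hX x⟩ ⟨VectorField.mlieBracket 𝓘(ℝ, E) Z Y x, killing_H Z hZ Y sY hY x⟩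
  isCompl : ∀ x : M, IsCompl (H x) (V.map (LinearMap.proj x))
  gV : LinearMap.BilinForm ℝ V
  gV_symm : ∀ Z W, gV Z W = gV W Z
  gV_pos : ∀ Z, Z ≠ 0 → 0 < gV Z Z

end SubRiemannian

namespace TransverseSymmetries

variable {E : Type*} [NormedAddCommGroup E] [NormedSpace ℝ E] [FiniteDimensional ℝ E]
  {M : Type*} [TopologicalSpace M] [ChartedSpace E M] [IsManifold 𝓘(ℝ, E) ∞ M]
  {d h : ℕ} (S : TransverseSymmetries E M d h)

/-- The map `(u, Z) ↦ u + Z(x)` from `H(x) × V` to the tangent space at `x`. -/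
def join (x : M) : (S.H x × S.V) →ₗ[ℝ] TangentSpace 𝓘(ℝ, E) x :=
  (S.H x).subtype.coprod ((LinearMap.proj x).comp S.V.subtype)

instance tangentFinite (x : M) : FiniteDimensional ℝ (TangentSpace 𝓘(ℝ, E) x) :=
  inferInstanceAs (FiniteDimensional ℝ E)

instance tangentT2 (x : M) : T2Space (TangentSpace 𝓘(ℝ, E) x) :=
  inferInstanceAs (T2Space E)

theorem join_bijective (x : M) : Function.Bijective (S.join x) := by
  have := S.finite_V
  have hs : Function.Surjective (S.join x) := by
    rw [← LinearMap.range_eq_top, join, LinearMap.range_coprod, Submodule.range_subtype,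
      LinearMap.range_comp, Submodule.range_subtype]
    exact (S.isCompl x).sup_eq_top
  have hd : finrank ℝ (S.H x × S.V) = finrank ℝ (TangentSpace 𝓘(ℝ, E) x) := by
    rw [finrank_prod, S.finrank_H, S.finrank_V]
    exact S.finrank_model.symm
  exact ⟨(LinearMap.injective_iff_surjective_of_finrank_eq_finrank hd).2 hs, hs⟩

/-- The splitting of a tangent vector into its horizontal part and the element of `V` whose value
is its vertical part. -/
def split (x : M) : TangentSpace 𝓘(ℝ, E) x ≃ₗ[ℝ] (S.H x × S.V) :=
  (LinearEquiv.ofBijective (S.join x) (S.join_bijective x)).symm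

/-- `gH`, extended by zero on vertical vectors. -/
def gHT (x : M) : LinearMap.BilinForm ℝ (TangentSpace 𝓘(ℝ, E) x) :=
  (S.gH x).compl₁₂ (LinearMap.fst ℝ _ _ ∘ₗ (S.split x).toLinearMap)
    (LinearMap.fst ℝ _ _ ∘ₗ (S.split x).toLinearMap)

/-- `gV` on tangent vectors, extended by zero on horizontal vectors. -/
def gVT (x : M) : LinearMap.BilinForm ℝ (TangentSpace 𝓘(ℝ, E) x) :=
  S.gV.compl₁₂ (LinearMap.snd ℝ _ _ ∘ₗ (S.split x).toLinearMap)
    (LinearMap.snd ℝ _ _ ∘ₗ (S.split x).toLinearMap)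

/-- A local adapted frame around `x`: `X₁, …, X_d` is a smooth `gH`-orthonormal frame of `H` on an
open neighbourhood `U` of `x`, and `Z₁, …, Z_h` is a `gV`-orthonormal basis of `V`. -/
structure AdaptedFrame (x : M) where
  U : Set M
  isOpen_U : IsOpen U
  mem_U : x ∈ U
  X : Fin d → VField E M
  smooth_X : ∀ i, (X i).SmoothOn U
  X_mem : ∀ y ∈ U, ∀ i, X i y ∈ S.H y
  X_orthonormal : ∀ y (hy : y ∈ U) i j,
    S.gH y ⟨X i y, X_mem y hy i⟩ ⟨X j y, X_mem y hy j⟩ = if i = j then 1 else 0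
  Z : Fin h → S.V
  Z_orthonormal : ∀ m l, S.gV (Z m) (Z l) = if m = l then 1 else 0

theorem exists_adaptedFrame (x : M) : Nonempty (S.AdaptedFrame x) := by
  have := S.finite_V
  obtain ⟨U, hU, hx, X, hX, hframe⟩ := S.exists_frame x
  choose hmem horth using hframe
  let core : InnerProductSpace.Core ℝ S.V :=
    { inner := fun Z W => S.gV Z W
      conj_inner_symm := fun Z W => S.gV_symm W Z
      re_inner_nonneg := fun Z => by
        by_cases hZ : Z = 0
        · simp [hZ]
        · exact (S.gV_pos Z hZ).le
      add_left := fun Z W Y => by simp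
      smul_left := fun Z W c => by simp
      definite := fun Z hZ => by
        by_contra hne
        exact (S.gV_pos Z hne).ne' hZ }
  let _ : NormedAddCommGroup S.V := core.toNormedAddCommGroup
  let _ : InnerProductSpace ℝ S.V := InnerProductSpace.ofCore core.toCore
  let b : OrthonormalBasis (Fin h) ℝ S.V :=
    (stdOrthonormalBasis ℝ S.V).reindex (finCongr S.finrank_V)
  exact ⟨⟨U, hU, hx, X, hX, hmem, horth, b, fun m l => orthonormal_iff_ite.1 b.orthonormal m l⟩⟩

namespace AdaptedFrame

variable {S} {x₀ : M} (F : S.AdaptedFrame x₀)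

/-- The vector fields underlying `Z₁, …, Z_h`. -/
def ZF (m : Fin h) : VField E M := (F.Z m).1

/-- The horizontal part `θ₁, …, θ_d` of the dual coframe. -/
def θ (i : Fin d) : OneForm E M := fun y =>
  LinearMap.toContinuousLinearMap ((S.gHT y).flip (F.X i y))

/-- The vertical part `ν₁, …, ν_h` of the dual coframe. -/
def ν (m : Fin h) : OneForm E M := fun y =>
  LinearMap.toContinuousLinearMap ((S.gVT y).flip (F.ZF m y))

/-- The metric `g_ε = g_H ⊕ ε g_V` on one-forms, making `θᵢ`, `ε^(-1/2) νₘ` orthonormal. -/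
def coInner (ε : ℝ) (η ζ : OneForm E M) (y : M) : ℝ :=
  ∑ i, η y (F.X i y) * ζ y (F.X i y) + ε * ∑ m, η y (F.ZF m y) * ζ y (F.ZF m y)

/-- `bracketXX i j k` (`ω_ij^k`): the `X_k`-component of `[X_i, X_j]`. -/
def bracketXX (i j k : Fin d) (y : M) : ℝ :=
  F.θ k y (VectorField.mlieBracket 𝓘(ℝ, E) (F.X i) (F.X j) y)

/-- `bracketXZ i m l` (`δ_im^l`): the `X_l`-component of `[X_i, Z_m]`. -/
def bracketXZ (i : Fin d) (m : Fin h) (l : Fin d) (y : M) : ℝ :=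
  F.θ l y (VectorField.mlieBracket 𝓘(ℝ, E) (F.X i) (F.ZF m) y)

/-- The canonical connection `∇_A B`: the one which is metric, preserves `H`, makes the elements of
`V` parallel, has vertical torsion on `H` and satisfies `T(H, V) = 0`. In the frame,
`∇_{X_i} X_j = ∑ₖ ½ (ω_ij^k + ω_ki^j + ω_kj^i) X_k`, `∇_{Z_m} X_i = - ∑ₖ δ_im^k X_k`,
`∇ Z_m = 0`. -/
def conn (A B : VField E M) : VField E M := fun y =>
  (∑ k, (A.deriv (fun z => F.θ k z (B z)) y
      + ∑ i, ∑ j, F.θ i y (A y) * F.θ j y (B y) *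
          (1 / 2 * (F.bracketXX i j k y + F.bracketXX k i j y + F.bracketXX k j i y))
      - ∑ m, ∑ i, F.ν m y (A y) * F.θ i y (B y) * F.bracketXZ i m k y) • F.X k y)
  + ∑ m, A.deriv (fun z => F.ν m z (B z)) y • F.ZF m y

/-- The torsion `T(A, B) = ∇_A B - ∇_B A - [A, B]`. -/
def torsion (A B : VField E M) : VField E M :=
  F.conn A B - F.conn B A - VectorField.mlieBracket 𝓘(ℝ, E) A B

/-- The curvature `R(A, B)C = ∇_A ∇_B C - ∇_B ∇_A C - ∇_[A, B] C`. -/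
def curvature (A B C : VField E M) : VField E M :=
  F.conn A (F.conn B C) - F.conn B (F.conn A C)
    - F.conn (VectorField.mlieBracket 𝓘(ℝ, E) A B) C

/-- The Ricci curvature `Ricci(A, B)`, the trace of `W ↦ R(W, A)B`. -/
def ricci (A B : VField E M) (y : M) : ℝ :=
  ∑ i, F.θ i y (F.curvature (F.X i) A B y) + ∑ m, F.ν m y (F.curvature (F.ZF m) A B y)

/-- The covariant derivative of a one-form, `(∇_A η)(B) = A(η(B)) - η(∇_A B)`. -/
def covForm (A : VField E M) (η : OneForm E M) : OneForm E M := fun y =>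
  ∑ j, (A.deriv (fun z => η z (F.X j z)) y - η y (F.conn A (F.X j) y)) • F.θ j y
  + ∑ m, (A.deriv (fun z => η z (F.ZF m z)) y - η y (F.conn A (F.ZF m) y)) • F.ν m y

/-- The sub-Laplacian on functions, `L = ∑ᵢ X_i² - ∇_{X_i} X_i`. -/
def lapFun (f : M → ℝ) (y : M) : ℝ :=
  ∑ i, ((F.X i).deriv ((F.X i).deriv f) y - (F.conn (F.X i) (F.X i)).deriv f y)

/-- The sub-Laplacian on one-forms, `L = ∑ᵢ ∇_{X_i} ∇_{X_i} - ∇_{∇_{X_i} X_i}`. -/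
def lapForm (η : OneForm E M) : OneForm E M := fun y =>
  ∑ i, (F.covForm (F.X i) (F.covForm (F.X i) η) y - F.covForm (F.conn (F.X i) (F.X i)) η y)

/-- The horizontal map `Ric_H` on one-forms with
`⟨Ric_H(df), dg⟩ = Ricci(∇_H f, ∇_H g)`. -/
def ricForm (η : OneForm E M) : OneForm E M := fun y =>
  ∑ k, ∑ l, (η y (F.X k y) * F.ricci (F.X k) (F.X l) y) • F.θ l y

/-- `J_{Z_m}` on one-forms, from `gH(J_Z X, Y) = gV(Z, T(X, Y))` by `θᵢ ↔ X_i`, `νₗ ↦ 0`. -/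
def JForm (m : Fin h) (α : OneForm E M) : OneForm E M := fun y =>
  ∑ i, ∑ j, (α y (F.X i y) * S.gVT y (F.ZF m y) (F.torsion (F.X i) (F.X j) y)) • F.θ j y

/-- The first order operator `𝔍 = ∑ₘ J_{Z_m} d ι_{Z_m}`. -/
def frakJ (η : OneForm E M) : OneForm E M := fun y =>
  ∑ m, F.JForm m (OneForm.ofFun (fun z => η z (F.ZF m z))) y

/-- `□_∞ = L + 2 𝔍 - Ric_H`. -/
def boxInfty (η : OneForm E M) : OneForm E M := fun y =>
  F.lapForm η y + (2 : ℝ) • F.frakJ η y - F.ricForm η y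

/-- The (horizontal) torsion as a fibrewise linear map from two-forms to one-forms:
`θᵢ ∧ θⱼ ↦ ∑ₘ gV(T(X_i, X_j), Z_m) νₘ`, while `θᵢ ∧ νₘ` and `νₗ ∧ νₘ` go to `0`. -/
def torsionDual (y : M) : TwoFormAt E M y →ₗ[ℝ] (TangentSpace 𝓘(ℝ, E) y →L[ℝ] ℝ) where
  toFun α := (1 / 2 : ℝ) • ∑ i, ∑ j, ∑ m, (α ![F.X i y, F.X j y] *
    S.gVT y (F.torsion (F.X i) (F.X j) y) (F.ZF m y)) • F.ν m y
  map_add' α β := by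
    simp only [ContinuousAlternatingMap.add_apply, add_mul, add_smul, Finset.sum_add_distrib,
      smul_add]
  map_smul' c α := by
    simp only [ContinuousAlternatingMap.smul_apply, smul_eq_mul, mul_assoc, RingHom.id_apply,
      Finset.smul_sum, smul_smul, mul_left_comm c]

/-- `□_∞ + Λ ∘ d` for a fibrewise linear map `Λ` from two-forms to one-forms. -/
def boxWith (Λ : (y : M) → TwoFormAt E M y →ₗ[ℝ] (TangentSpace 𝓘(ℝ, E) y →L[ℝ] ℝ))
    (η : OneForm E M) : OneForm E M := fun y => F.boxInfty η y + Λ y (η.extDerivAt y)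

/-- The infimum, over smooth one-forms `η` with `‖η(x₀)‖_ε = 1`, of
`½ (L ‖η‖²_ε)(x₀) - ⟨(□_∞ + Λ ∘ d) η, η⟩_ε (x₀)`, as an extended real number. -/
def bochnerInf (ε : ℝ)
    (Λ : (y : M) → TwoFormAt E M y →ₗ[ℝ] (TangentSpace 𝓘(ℝ, E) y →L[ℝ] ℝ)) : EReal :=
  ⨅ (η : OneForm E M) (_ : η.Smooth) (_ : F.coInner ε η η x₀ = 1),
    ((1 / 2 * F.lapFun (F.coInner ε η η) x₀ - F.coInner ε (F.boxWith Λ η) η x₀ : ℝ) : EReal)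

end AdaptedFrame

end TransverseSymmetries

end

/-! By the Bochner formula the quantity under the infimum is of first order in `η`. Put `a i j =
(∇_{X_i} η)(X_j)`, `q i m = X_i(η(Z_m))`, `Γ i j = ∑ₘ γ_ij^m η(Z_m)` and `P i m = ∑ₖ γ_ik^m η(X_k)`.
Then `bochner_expansion` turns it into `∑ a² + ε ∑ q² + 2 ∑ q P + ⟨Ric η, η⟩ - ⟨Λ dη, η⟩`, where
`Γ`, `P` and the Ricci term depend only on the value of `η` at the point.

For `Λ = -T/ε` the last pairing is `½ ∑ dη(X_i, X_j) Γ i j`, with `dη(X_i, X_j) = a i j - a j i - Γ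
i j`. Completing squares (`bochner_quadratic_lower_bound`) shows that, for a fixed value of `η`, the
minimum is reached at `a = Γ/2`, `q = -P/ε`. Since `Γ` is skew, this choice makes `dη` vanish on
horizontal pairs. The derivatives along `Z_m` do not enter this quadratic form, so they can be used
to cancel the rest of `dη` (`exists_optimal_oneForm`).

The minimiser is thus closed at the point, where no `Λ ∘ d` can see it. For each competitor `η` on
the right, the minimiser `ζ` with the same value gives on the left exactly the minimum of the
right-hand form, which is at most its value at `η`. -/

noncomputable section

set_option linter.unusedSectionVars false

/-! ### Derivations along vector fields and smoothness of one-forms -/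

section ManifoldCalculus

variable {E : Type*} [NormedAddCommGroup E] [NormedSpace ℝ E]
  {M : Type*} [TopologicalSpace M] [ChartedSpace E M]

theorem VField.deriv_congr_of_eventuallyEq (X : VField E M) {f g : M → ℝ} {x : M} (h : f =ᶠ[𝓝 x] g) :
    X.deriv f x = X.deriv g x := by
  rw [VField.deriv, VField.deriv, h.mfderiv_eq]
  rfl

theorem VField.deriv_const (X : VField E M) (c : ℝ) (x : M) : X.deriv (fun _ => c) x = 0 := by
  rw [VField.deriv, mfderiv_const]; rfl

theorem VField.deriv_of_hasMFDerivAt (X : VField E M) {f : M → ℝ} {x : M}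
    {f' : TangentSpace 𝓘(ℝ, E) x →L[ℝ] ℝ} (hf : HasMFDerivAt 𝓘(ℝ, E) 𝓘(ℝ, ℝ) f x f') :
    X.deriv f x = f' (X x) := by
  rw [VField.deriv, hf.mfderiv]
  rfl

theorem VField.deriv_add (X : VField E M) {f g : M → ℝ} {x : M}
    (hf : MDifferentiableAt 𝓘(ℝ, E) 𝓘(ℝ, ℝ) f x) (hg : MDifferentiableAt 𝓘(ℝ, E) 𝓘(ℝ, ℝ) g x) :
    X.deriv (fun y => f y + g y) x = X.deriv f x + X.deriv g x := by
  exact X.deriv_of_hasMFDerivAt (hf.hasMFDerivAt.add hg.hasMFDerivAt)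

theorem VField.deriv_mul (X : VField E M) {f g : M → ℝ} {x : M}
    (hf : MDifferentiableAt 𝓘(ℝ, E) 𝓘(ℝ, ℝ) f x) (hg : MDifferentiableAt 𝓘(ℝ, E) 𝓘(ℝ, ℝ) g x) :
    X.deriv (fun y => f y * g y) x = f x * X.deriv g x + X.deriv f x * g x := by
  refine (X.deriv_of_hasMFDerivAt (hf.hasMFDerivAt.mul hg.hasMFDerivAt)).trans ?_
  rw [mul_comm (X.deriv f x)]
  rfl

theorem VField.deriv_const_mul (X : VField E M) (c : ℝ) {f : M → ℝ} {x : M}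
    (hf : MDifferentiableAt 𝓘(ℝ, E) 𝓘(ℝ, ℝ) f x) :
    X.deriv (fun y => c * f y) x = c * X.deriv f x := by
  rw [X.deriv_mul mdifferentiableAt_const hf, X.deriv_const, zero_mul, add_zero]

/-- Both conclusions are proved in one induction, since additivity of the derivative at each step
needs differentiability of the partial sum. -/
theorem VField.mdifferentiableAt_and_deriv_sum (X : VField E M) {ι : Type*} (s : Finset ι)
    {f : ι → M → ℝ} {x : M} (hf : ∀ i ∈ s, MDifferentiableAt 𝓘(ℝ, E) 𝓘(ℝ, ℝ) (f i) x) :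
    MDifferentiableAt 𝓘(ℝ, E) 𝓘(ℝ, ℝ) (fun y => ∑ i ∈ s, f i y) x ∧
      X.deriv (fun y => ∑ i ∈ s, f i y) x = ∑ i ∈ s, X.deriv (f i) x := by
  classical
  induction s using Finset.induction_on with
  | empty => simpa using ⟨mdifferentiableAt_const, X.deriv_const 0 x⟩
  | insert i s his ih =>
    obtain ⟨h1, h2⟩ := ih fun j hj => hf j (Finset.mem_insert_of_mem hj)
    have hi := hf i (Finset.mem_insert_self i s)
    simp only [Finset.sum_insert his]
    rw [X.deriv_add hi h1, h2]
    exact ⟨hi.add h1, rfl⟩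

theorem VField.deriv_sum (X : VField E M) {ι : Type*} (s : Finset ι) {f : ι → M → ℝ} {x : M}
    (hf : ∀ i ∈ s, MDifferentiableAt 𝓘(ℝ, E) 𝓘(ℝ, ℝ) (f i) x) :
    X.deriv (fun y => ∑ i ∈ s, f i y) x = ∑ i ∈ s, X.deriv (f i) x :=
  (X.mdifferentiableAt_and_deriv_sum s hf).2

variable [IsManifold 𝓘(ℝ, E) ∞ M]

/-- A vector field is smooth at a point. -/
abbrev VField.SmoothAt (X : VField E M) (x : M) : Prop :=
  ContMDiffAt 𝓘(ℝ, E) (𝓘(ℝ, E).prod 𝓘(ℝ, E)) ∞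
    (fun x => (Bundle.TotalSpace.mk' E x (X x) : TangentBundle 𝓘(ℝ, E) M)) x

/-- A one-form is smooth at a point. -/
abbrev OneForm.SmoothAt (η : OneForm E M) (x : M) : Prop :=
  ContMDiffAt 𝓘(ℝ, E) (𝓘(ℝ, E).prod 𝓘(ℝ, E →L[ℝ] ℝ)) ∞
    (fun x => Bundle.TotalSpace.mk' (E →L[ℝ] ℝ)
      (E := fun x : M => TangentSpace 𝓘(ℝ, E) x →L[ℝ] Bundle.Trivial M ℝ x) x (η x)) x

theorem OneForm.SmoothAt.apply {η : OneForm E M} {X : VField E M} {x : M}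
    (hη : η.SmoothAt x) (hX : X.SmoothAt x) :
    ContMDiffAt 𝓘(ℝ, E) 𝓘(ℝ, ℝ) ∞ (fun y => η y (X y)) x := by
  have := ContMDiffAt.clm_bundle_apply hη hX
  exact (Bundle.contMDiffAt_section x).1 this

theorem OneForm.smoothAt_ofFun {f : M → ℝ} {x : M} (hf : ContMDiffAt 𝓘(ℝ, E) 𝓘(ℝ, ℝ) ∞ f x) :
    (OneForm.ofFun f : OneForm E M).SmoothAt x := by
  refine (contMDiffAt_hom_bundle _).2 ⟨contMDiffAt_id, ?_⟩
  have := hf.mfderiv_const (m := ∞) (by simp)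
  refine this.congr_of_eventuallyEq (Eventually.of_forall fun y => ?_)
  unfold inTangentCoordinates ContinuousLinearMap.inCoordinates
  ext v
  simp [OneForm.ofFun]
  rfl

theorem VField.SmoothAt.contMDiffAt_deriv {X : VField E M} {x : M} (hX : X.SmoothAt x) {f : M → ℝ}
    (hf : ContMDiffAt 𝓘(ℝ, E) 𝓘(ℝ, ℝ) ∞ f x) :
    ContMDiffAt 𝓘(ℝ, E) 𝓘(ℝ, ℝ) ∞ (X.deriv f) x :=
  (OneForm.smoothAt_ofFun hf).apply hX

theorem OneForm.SmoothAt.add {η ξ : OneForm E M} {x : M} (hη : η.SmoothAt x)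
    (hξ : ξ.SmoothAt x) : (η + ξ).SmoothAt x :=
  ContMDiffAt.add_section hη hξ

theorem OneForm.SmoothAt.smul {η : OneForm E M} {x : M} (hη : η.SmoothAt x) {f : M → ℝ}
    (hf : ContMDiffAt 𝓘(ℝ, E) 𝓘(ℝ, ℝ) ∞ f x) : OneForm.SmoothAt (fun y => f y • η y) x :=
  ContMDiffAt.smul_section hf hη

theorem OneForm.SmoothAt.sum {ι : Type*} (s : Finset ι) {η : ι → OneForm E M} {x : M}
    (hη : ∀ i ∈ s, (η i).SmoothAt x) : OneForm.SmoothAt (fun y => ∑ i ∈ s, η i y) x :=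
  ContMDiffAt.sum_section hη

end ManifoldCalculus

/-! ### Cartan's formula for the exterior derivative -/

section ExteriorDerivative

variable {E : Type*} [NormedAddCommGroup E] [NormedSpace ℝ E]
  {M : Type*} [TopologicalSpace M] [ChartedSpace E M] [IsManifold 𝓘(ℝ, E) ∞ M]

/-- A one-form read in the preferred chart at `x`. -/
def OneForm.inChart (η : OneForm E M) (x : M) (z : E) : E →L[ℝ] ℝ :=
  (η ((extChartAt 𝓘(ℝ, E) x).symm z)).comp
        (mfderiv 𝓘(ℝ, E) 𝓘(ℝ, E) (extChartAt 𝓘(ℝ, E) x).symm z)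

/-- On the chart domain the tangent trivialization at `x` is inverted by the differential of the
inverse chart. The chart expression is therefore the trivialized section composed with the inverse
chart. -/
theorem OneForm.SmoothAt.differentiableAt_inChart {η : OneForm E M} {x : M} (hη : η.SmoothAt x) :
    DifferentiableAt ℝ (η.inChart x) (extChartAt 𝓘(ℝ, E) x x) := by
  have h := ((contMDiffAt_hom_bundle _).1 hη).2
  have hs : ContMDiffAt 𝓘(ℝ, E) 𝓘(ℝ, E) ∞ (extChartAt 𝓘(ℝ, E) x).symm
      (extChartAt 𝓘(ℝ, E) x x) :=
    (contMDiffOn_extChartAt_symm x).contMDiffAt (extChartAt_target_mem_nhds x)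
  have h2 := ContMDiffAt.comp_of_eq h hs (extChartAt_to_inv x)
  refine ((contMDiffAt_iff_contDiffAt.1 h2).differentiableAt (by simp)).congr_of_eventuallyEq ?_
  filter_upwards [extChartAt_target_mem_nhds (I := 𝓘(ℝ, E)) x] with z hz
  have hz' : (extChartAt 𝓘(ℝ, E) x).symm z ∈ (chartAt E x).source := by
    rw [← extChartAt_source 𝓘(ℝ, E)]
    exact (extChartAt 𝓘(ℝ, E) x).map_target hz
  have e := TangentBundle.symmL_trivializationAt (I := 𝓘(ℝ, E)) hz'
  simp only [Function.comp_def, ContinuousLinearMap.inCoordinates]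
  rw [e, (extChartAt 𝓘(ℝ, E) x).right_inv hz]
  ext v
  simp [OneForm.inChart]

/-- A vector field read in the preferred chart at `x`. -/
def VField.inChart (X : VField E M) (x : M) : E → E :=
  VectorField.mpullbackWithin 𝓘(ℝ, E) 𝓘(ℝ, E) (extChartAt 𝓘(ℝ, E) x).symm X (range 𝓘(ℝ, E))

theorem VField.SmoothAt.differentiableAt_inChart [CompleteSpace E] {X : VField E M} {x : M}
    (hX : X.SmoothAt x) : DifferentiableAt ℝ (X.inChart x) (extChartAt 𝓘(ℝ, E) x x) := by
  have : IsManifold 𝓘(ℝ, E) 2 M := IsManifold.of_le (n := ∞) ENat.LEInfty.out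
  have h := (hX.mdifferentiableAt (by simp)).mdifferentiableWithinAt (s := univ)
    |>.differentiableWithinAt_mpullbackWithin_vectorField
  rw [← differentiableWithinAt_univ]
  simpa [VField.inChart] using h

theorem VField.inChart_self (X : VField E M) (x : M) :
    X.inChart x (extChartAt 𝓘(ℝ, E) x x) = X x := by
  have : IsManifold 𝓘(ℝ, E) 1 M := IsManifold.of_le (n := ∞) (by exact_mod_cast le_top)
  rw [VField.inChart, VectorField.mpullbackWithin_apply, extChartAt_to_inv]
  exact mfderivWithin_extChartAt_symm_inverse_apply _

theorem OneForm.inChart_self (η : OneForm E M) (x : M) :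
    η.inChart x (extChartAt 𝓘(ℝ, E) x x) = η x := by
  have : IsManifold 𝓘(ℝ, E) 1 M := IsManifold.of_le (n := ∞) (by exact_mod_cast le_top)
  have h := mfderivWithin_range_extChartAt_symm (I := 𝓘(ℝ, E)) (x := x)
  simp only [modelWithCornersSelf_coe, range_id, mfderivWithin_univ] at h
  rw [OneForm.inChart, h, extChartAt_to_inv]
  exact ContinuousLinearMap.comp_id _

/-- A form is pulled back by the differential of the inverse chart and a field by the inverse of
that differential, so the two cancel in the pairing. -/
theorem OneForm.inChart_apply_inChart (η : OneForm E M) (X : VField E M) (x : M) :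
    (fun z => η.inChart x z (X.inChart x z)) =ᶠ[𝓝 (extChartAt 𝓘(ℝ, E) x x)]
      (fun y => η y (X y)) ∘ (extChartAt 𝓘(ℝ, E) x).symm := by
  have : IsManifold 𝓘(ℝ, E) 1 M := IsManifold.of_le (n := ∞) (by exact_mod_cast le_top)
  filter_upwards [extChartAt_target_mem_nhds (I := 𝓘(ℝ, E)) x] with z hz
  have h := isInvertible_mfderivWithin_extChartAt_symm (I := 𝓘(ℝ, E)) hz
  simp only [modelWithCornersSelf_coe, range_id, mfderivWithin_univ] at h
  simp only [OneForm.inChart, VField.inChart, VectorField.mpullbackWithin_apply,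
    modelWithCornersSelf_coe, range_id, mfderivWithin_univ, Function.comp_apply]
  exact congrArg _ (h.self_apply_inverse _)

theorem VField.deriv_eq_fderiv (X : VField E M) {f : M → ℝ} {x : M}
    (hf : MDifferentiableAt 𝓘(ℝ, E) 𝓘(ℝ, ℝ) f x) :
    X.deriv f x = fderiv ℝ (f ∘ (extChartAt 𝓘(ℝ, E) x).symm) (extChartAt 𝓘(ℝ, E) x x) (X x) := by
  rw [VField.deriv, hf.mfderiv]
  simp [writtenInExtChartAt]
  rfl

theorem VField.mlieBracket_eq_lieBracket_inChart (X Y : VField E M) (x : M) :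
    VectorField.mlieBracket 𝓘(ℝ, E) X Y x =
      VectorField.lieBracket ℝ (X.inChart x) (Y.inChart x) (extChartAt 𝓘(ℝ, E) x x) := by
  have : IsManifold 𝓘(ℝ, E) 1 M := IsManifold.of_le (n := ∞) (by exact_mod_cast le_top)
  rw [← VectorField.mlieBracketWithin_univ, VectorField.mlieBracketWithin_apply,
    mfderiv_extChartAt_self]
  have hid : (ContinuousLinearMap.id ℝ (TangentSpace 𝓘(ℝ, E) x)).inverse =
      ContinuousLinearMap.id ℝ (TangentSpace 𝓘(ℝ, E) x) := ContinuousLinearMap.inverse_id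
  refine (congrArg (fun T : TangentSpace 𝓘(ℝ, E) x →L[ℝ] TangentSpace 𝓘(ℝ, E) x => T _) hid).trans ?_
  rw [← VectorField.lieBracketWithin_univ]
  simp [VField.inChart]
  rfl

theorem extDeriv_ofSubsingleton_apply {α : E → E →L[ℝ] ℝ} {V W : E → E} {z : E}
    (hα : DifferentiableAt ℝ α z) (hV : DifferentiableAt ℝ V z) (hW : DifferentiableAt ℝ W z) :
    extDeriv (fun z : E => ContinuousAlternatingMap.ofSubsingleton ℝ E ℝ (0 : Fin 1) (α z)) z
      ![V z, W z] = fderiv ℝ (fun y => α y (W y)) z (V z) - fderiv ℝ (fun y => α y (V y)) z (W z)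
        - α z (VectorField.lieBracket ℝ V W z) := by
  have hω : DifferentiableAt ℝ (fun z : E => ContinuousAlternatingMap.ofSubsingleton ℝ E ℝ
      (0 : Fin 1) (α z)) z :=
    (ContinuousAlternatingMap.ofSubsingletonLIE (𝕜 := ℝ) (E := E) (F := ℝ)
      (0 : Fin 1)).differentiableAt.comp z hα
  have h := extDeriv_apply_vectorField (n := 0) (V := ![V, W]) hω (by
    intro i
    fin_cases i
    · exact hV
    · exact hW)
  have e : (fun i => (![V, W] : Fin 2 → E → E) i z) = ![V z, W z] := by
    ext i
    fin_cases i <;> rfl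
  rw [e] at h
  rw [h]
  simp [Fin.sum_univ_two, Fin.removeNth, sub_eq_add_neg]

/-- Cartan's formula holds in the model space for chart expressions. It transfers because the
differential of the preferred chart at its own base point is the identity. -/
theorem OneForm.extDerivAt_apply [CompleteSpace E] {η : OneForm E M} {X Y : VField E M} {x : M}
    (hη : η.SmoothAt x) (hX : X.SmoothAt x) (hY : Y.SmoothAt x) :
    η.extDerivAt x ![X x, Y x] = X.deriv (fun y => η y (Y y)) x - Y.deriv (fun y => η y (X y)) x
      - η x (VectorField.mlieBracket 𝓘(ℝ, E) X Y x) := by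
  have : IsManifold 𝓘(ℝ, E) 1 M := IsManifold.of_le (n := ∞) (by exact_mod_cast le_top)
  have h := extDeriv_ofSubsingleton_apply hη.differentiableAt_inChart
    hX.differentiableAt_inChart hY.differentiableAt_inChart
  rw [X.deriv_eq_fderiv ((hη.apply hY).mdifferentiableAt (by simp)),
    Y.deriv_eq_fderiv ((hη.apply hX).mdifferentiableAt (by simp)),
    VField.mlieBracket_eq_lieBracket_inChart,
    ← (η.inChart_apply_inChart Y x).fderiv_eq, ← (η.inChart_apply_inChart X x).fderiv_eq]
  rw [X.inChart_self, Y.inChart_self, η.inChart_self] at h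
  refine Eq.trans ?_ h
  rw [OneForm.extDerivAt, mfderiv_extChartAt_self]
  rfl

end ExteriorDerivative

/-! ### Global one-forms with prescribed first derivatives at a point -/

section PrescribedJet

variable {E : Type*} [NormedAddCommGroup E] [NormedSpace ℝ E] [FiniteDimensional ℝ E]
  {M : Type*} [TopologicalSpace M] [T2Space M] [ChartedSpace E M] [IsManifold 𝓘(ℝ, E) ∞ M]

/-- The chart at a point, recentred, extends to a global smooth map. -/
theorem exists_contMDiff_coordinates (x : M) : ∃ w : M → E,
    ContMDiff 𝓘(ℝ, E) 𝓘(ℝ, E) ∞ w ∧ w x = 0 ∧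
      HasMFDerivAt 𝓘(ℝ, E) 𝓘(ℝ, E) w x (ContinuousLinearMap.id ℝ E) := by
  have : IsManifold 𝓘(ℝ, E) 1 M := IsManifold.of_le (n := ∞) (by exact_mod_cast le_top)
  obtain ⟨χ⟩ : Nonempty (SmoothBumpFunction 𝓘(ℝ, E) x) := inferInstance
  let g : M → E := fun y => extChartAt 𝓘(ℝ, E) x y - extChartAt 𝓘(ℝ, E) x x
  have hg : ContMDiffOn 𝓘(ℝ, E) 𝓘(ℝ, E) ∞ g (chartAt E x).source :=
    contMDiffOn_extChartAt.sub contMDiffOn_const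
  -- The bump function makes the chart map globally smooth; it equals `1` near `x`, so the germ at
  -- `x` is unchanged.
  refine ⟨fun y => χ y • g y, χ.contMDiff_smul hg, by simp [g], ?_⟩
  have hev : (fun y => χ y • g y) =ᶠ[𝓝 x] g := by
    filter_upwards [χ.eventuallyEq_one] with y hy
    simp [hy]
  have h2 : HasMFDerivAt 𝓘(ℝ, E) 𝓘(ℝ, E) g x (mfderiv 𝓘(ℝ, E) 𝓘(ℝ, E) (extChartAt 𝓘(ℝ, E) x) x) := by
    have := (mdifferentiableAt_extChartAt (I := 𝓘(ℝ, E)) (mem_chart_source E x)).hasMFDerivAt.sub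
      (hasMFDerivAt_const (extChartAt 𝓘(ℝ, E) x x) x)
    have h0 : mfderiv 𝓘(ℝ, E) 𝓘(ℝ, E) (extChartAt 𝓘(ℝ, E) x) x - 0 =
      mfderiv 𝓘(ℝ, E) 𝓘(ℝ, E) (extChartAt 𝓘(ℝ, E) x) x := sub_zero _
    exact (congrArg (HasMFDerivAt 𝓘(ℝ, E) 𝓘(ℝ, E) g x) h0).mp this
  rw [mfderiv_extChartAt_self] at h2
  exact h2.congr_of_eventuallyEq hev

/-- There is a global smooth one-form which vanishes at `x` and has prescribed first derivatives
there. -/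
theorem exists_smooth_oneForm_deriv (x : M) (B : E →ₗ[ℝ] E →ₗ[ℝ] ℝ) : ∃ ξ : OneForm E M,
    ξ.Smooth ∧ ξ x = 0 ∧ ∀ X Y : VField E M, Y.SmoothAt x →
      X.deriv (fun y => ξ y (Y y)) x = B (X x) (Y x) := by
  obtain ⟨w, hw, hw0, hdw⟩ := exists_contMDiff_coordinates (E := E) x
  let b := Module.finBasis ℝ E
  let u : Fin (finrank ℝ E) → M → ℝ := fun k y => LinearMap.toContinuousLinearMap (B.flip (b k)) (w y)
  let v : Fin (finrank ℝ E) → M → ℝ := fun k y => LinearMap.toContinuousLinearMap (b.coord k) (w y)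
  have hu (k) : ContMDiff 𝓘(ℝ, E) 𝓘(ℝ, ℝ) ∞ (u k) :=
    (ContinuousLinearMap.contMDiff _).comp hw
  have hv (k) : ContMDiff 𝓘(ℝ, E) 𝓘(ℝ, ℝ) ∞ (v k) :=
    (ContinuousLinearMap.contMDiff _).comp hw
  have du (k) (X : VField E M) : X.deriv (u k) x = B (X x) (b k) :=
    X.deriv_of_hasMFDerivAt ((ContinuousLinearMap.hasMFDerivAt _).comp x hdw)
  have dv (k) (X : VField E M) : X.deriv (v k) x = b.coord k (X x) :=
    X.deriv_of_hasMFDerivAt ((ContinuousLinearMap.hasMFDerivAt _).comp x hdw)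
  have hu0 (k) : u k x = 0 := by simp [u, hw0]
  -- The form is `ξ = ∑ₖ B(w, b_k) d(b_k^*(w))`. The first factors vanish at `x`, so by Leibniz only
  -- their derivatives survive, leaving `∑ₖ B(X, b_k) b_k^*(Y) = B(X, Y)`.
  refine ⟨fun y => ∑ k, u k y • OneForm.ofFun (v k) y, fun y => ?_, ?_, fun X Y hY => ?_⟩
  · exact OneForm.SmoothAt.sum _ fun k _ =>
      (OneForm.smoothAt_ofFun (hv k).contMDiffAt).smul (hu k).contMDiffAt
  · simp [hu0]
  · have e : (fun y => (∑ k, u k y • OneForm.ofFun (v k) y : TangentSpace 𝓘(ℝ, E) y →L[ℝ] ℝ) (Y y)) =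
        fun y => ∑ k, u k y * Y.deriv (v k) y := by
      ext y
      rw [sum_apply]
      rfl
    have hd (k) : MDifferentiableAt 𝓘(ℝ, E) 𝓘(ℝ, ℝ) (Y.deriv (v k)) x :=
      (hY.contMDiffAt_deriv (hv k).contMDiffAt).mdifferentiableAt (by simp)
    have hud (k) : MDifferentiableAt 𝓘(ℝ, E) 𝓘(ℝ, ℝ) (u k) x :=
      (hu k).mdifferentiableAt (by simp)
    rw [e]
    refine (X.deriv_sum _ fun k _ => (hud k).mul (hd k)).trans ?_
    have expand (a c : E) : ∑ k, B a (b k) * b.coord k c = B a c := by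
      have h := congrArg (B a) (b.sum_repr c)
      simp only [map_sum, map_smul, smul_eq_mul] at h
      simpa only [Basis.coord_apply, mul_comm] using h
    refine (Finset.sum_congr rfl fun k _ => ?_).trans (expand (X x) (Y x))
    refine (X.deriv_mul (hud k) (hd k)).trans ?_
    rw [hu0, zero_mul, zero_add, du, dv]

end PrescribedJet

/-! ### Smoothness of coefficients in a smooth frame -/

section SmoothDualFrame

variable {E : Type*} [NormedAddCommGroup E] [NormedSpace ℝ E]
  {M : Type*} [TopologicalSpace M] [ChartedSpace E M] [IsManifold 𝓘(ℝ, E) ∞ M]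

/-- The coefficients of a smooth vector field in a smooth local frame are smooth. -/
theorem VField.SmoothAt.contMDiffAt_coeff {ι : Type*} [Fintype ι] {X : ι → VField E M} {x : M}
    (b : (y : M) → Basis ι ℝ (TangentSpace 𝓘(ℝ, E) y)) (hb : ∀ᶠ y in 𝓝 x, ∀ a, b y a = X a y)
    (hX : ∀ a, (X a).SmoothAt x) {Y : VField E M} (hY : Y.SmoothAt x) (a : ι) :
    ContMDiffAt 𝓘(ℝ, E) 𝓘(ℝ, ℝ) ∞ (fun y => (b y).repr (Y y) a) x := by
  let t := trivializationAt E (TangentSpace 𝓘(ℝ, E) : M → Type _) x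
  let v : ι → M → E := fun a y => (t ⟨y, X a y⟩).2
  have hv (a) : ContMDiffAt 𝓘(ℝ, E) 𝓘(ℝ, E) ∞ (v a) x := (Bundle.contMDiffAt_section x).1 (hX a)
  have hw : ContMDiffAt 𝓘(ℝ, E) 𝓘(ℝ, E) ∞ (fun y => (t ⟨y, Y y⟩).2) x :=
    (Bundle.contMDiffAt_section x).1 hY
  -- `A y` sends coefficients to the trivialized vector they represent in the frame. It depends
  -- smoothly on `y` and is invertible near `x`, so smoothness of operator inversion gives smooth
  -- coefficients.
  let A : M → (ι → ℝ) →L[ℝ] E := fun y =>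
    ∑ a, ContinuousLinearMap.smulRightL ℝ (ι → ℝ) E (ContinuousLinearMap.proj a) (v a y)
  have hA : ContMDiffAt 𝓘(ℝ, E) 𝓘(ℝ, (ι → ℝ) →L[ℝ] E) ∞ A x :=
    contMDiffAt_finsetSum fun a _ =>
      (ContinuousLinearMap.contMDiff _).contMDiffAt.comp x (hv a)
  have hmem : ∀ᶠ y in 𝓝 x, y ∈ t.baseSet :=
    t.open_baseSet.mem_nhds (FiberBundle.mem_baseSet_trivializationAt' x)
  have key : ∀ᶠ y in 𝓝 x, ∃ T : (ι → ℝ) ≃L[ℝ] E, (T : (ι → ℝ) →L[ℝ] E) = A y ∧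
      T (fun a => (b y).repr (Y y) a) = (t ⟨y, Y y⟩).2 := by
    filter_upwards [hb, hmem] with y hy hm
    let T : (ι → ℝ) ≃ₗ[ℝ] E := (b y).equivFun.symm.trans (t.linearEquivAt ℝ y hm)
    refine ⟨T.toContinuousLinearEquiv, ?_, ?_⟩
    · ext c
      simp [T, A, Basis.equivFun_symm_apply, hy, v]
    · change t.linearEquivAt ℝ y hm ((b y).equivFun.symm ((b y).equivFun (Y y))) = _
      rw [LinearEquiv.symm_apply_apply]
      rfl
  obtain ⟨T, hT, -⟩ := key.self_of_nhds
  have hinv : ContMDiffAt 𝓘(ℝ, E) 𝓘(ℝ, E →L[ℝ] (ι → ℝ)) ∞ (fun y => (A y).inverse) x := by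
    have := (contDiffAt_map_inverse (n := ∞) T).contMDiffAt
    rw [hT] at this
    exact this.comp x hA
  have hc : ContMDiffAt 𝓘(ℝ, E) 𝓘(ℝ, ι → ℝ) ∞
      (fun y => (A y).inverse (t ⟨y, Y y⟩).2) x := hinv.clm_apply hw
  refine (contMDiffAt_pi_space.1 hc a).congr_of_eventuallyEq ?_
  filter_upwards [key] with y ⟨T, hT, hTY⟩
  rw [← hT, ← hTY, ContinuousLinearMap.inverse_equiv]
  simp

end SmoothDualFrame

/-! ### Adapted frames, the canonical connection and the Bochner formula -/

namespace TransverseSymmetries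

namespace AdaptedFrame

variable {E : Type*} [NormedAddCommGroup E] [NormedSpace ℝ E] [FiniteDimensional ℝ E]
  {M : Type*} [TopologicalSpace M] [ChartedSpace E M] [IsManifold 𝓘(ℝ, E) ∞ M]
  {d h : ℕ} {S : TransverseSymmetries E M d h} {x₀ : M} (F : S.AdaptedFrame x₀) {y : M}

theorem split_X (hy : y ∈ F.U) (i : Fin d) :
    S.split y (F.X i y) = (⟨F.X i y, F.X_mem y hy i⟩, 0) := by
  rw [split, LinearEquiv.symm_apply_eq]
  simp [join]

variable (y) in
theorem split_ZF (m : Fin h) : S.split y (F.ZF m y) = (0, F.Z m) := by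
  rw [split, LinearEquiv.symm_apply_eq]
  simp [join, ZF]

theorem θ_X (hy : y ∈ F.U) (i j : Fin d) : F.θ i y (F.X j y) = if j = i then 1 else 0 := by
  rw [← F.X_orthonormal y hy j i]
  simp [θ, gHT, F.split_X hy]

variable (y) in
theorem θ_ZF (i : Fin d) (m : Fin h) : F.θ i y (F.ZF m y) = 0 := by
  simp [θ, gHT, F.split_ZF]

theorem ν_X (hy : y ∈ F.U) (m : Fin h) (i : Fin d) : F.ν m y (F.X i y) = 0 := by
  simp [ν, gVT, F.split_X hy]

variable (y) in
theorem ν_ZF (m l : Fin h) : F.ν m y (F.ZF l y) = if l = m then 1 else 0 := by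
  rw [← F.Z_orthonormal l m]
  simp [ν, gVT, F.split_ZF]

variable (y) in
theorem gVT_ZF_left (m : Fin h) (u : TangentSpace 𝓘(ℝ, E) y) : S.gVT y (F.ZF m y) u = F.ν m y u := by
  simp [ν, gVT, S.gV_symm (F.Z m), F.split_ZF]

variable (y) in
theorem gVT_ZF_right (m : Fin h) (u : TangentSpace 𝓘(ℝ, E) y) : S.gVT y u (F.ZF m y) = F.ν m y u :=
  rfl

/-- The fields `X₁, …, X_d, Z₁, …, Z_h` as one family. -/
def frame (a : Fin d ⊕ Fin h) : VField E M := Sum.elim F.X F.ZF a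

/-- The forms `θ₁, …, θ_d, ν₁, …, ν_h` as one family. -/
def coframe (a : Fin d ⊕ Fin h) : OneForm E M := Sum.elim F.θ F.ν a

theorem coframe_frame (hy : y ∈ F.U) (a b : Fin d ⊕ Fin h) :
    F.coframe a y (F.frame b y) = if b = a then 1 else 0 := by
  rcases a with i | m <;> rcases b with j | l
  · simpa [coframe, frame] using F.θ_X hy i j
  · simpa [coframe, frame] using F.θ_ZF y i l
  · simpa [coframe, frame] using F.ν_X hy m j
  · simpa [coframe, frame] using F.ν_ZF y m l

theorem linearIndependent_frame (hy : y ∈ F.U) :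
    LinearIndependent ℝ (fun a => F.frame a y) := by
  rw [Fintype.linearIndependent_iff]
  intro c hc a
  have := congrArg (F.coframe a y) hc
  simpa [-Fintype.sum_sum_type, F.coframe_frame hy] using this

/-- The basis of the tangent space given by an adapted frame. -/
def basisAt (hy : y ∈ F.U) : Basis (Fin d ⊕ Fin h) ℝ (TangentSpace 𝓘(ℝ, E) y) :=
  basisOfLinearIndependentOfCardEqFinrank' (fun a => F.frame a y) (F.linearIndependent_frame hy) (by
    rw [Fintype.card_sum, Fintype.card_fin, Fintype.card_fin]
    exact S.finrank_model.symm)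

theorem basisAt_apply (hy : y ∈ F.U) (a : Fin d ⊕ Fin h) : F.basisAt hy a = F.frame a y := by
  simp [basisAt]

theorem basisAt_repr (hy : y ∈ F.U) (u : TangentSpace 𝓘(ℝ, E) y) (a : Fin d ⊕ Fin h) :
    (F.basisAt hy).repr u a = F.coframe a y u := by
  have h : F.coframe a y u = F.coframe a y (∑ b, (F.basisAt hy).repr u b • F.basisAt hy b) := by
    rw [(F.basisAt hy).sum_repr]
  rw [h]
  simp [-Fintype.sum_sum_type, F.basisAt_apply, F.coframe_frame hy]

theorem eq_sum_frame (hy : y ∈ F.U) (u : TangentSpace 𝓘(ℝ, E) y) :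
    u = ∑ i, F.θ i y u • F.X i y + ∑ m, F.ν m y u • F.ZF m y := by
  conv_lhs => rw [← (F.basisAt hy).sum_repr u]
  simp [Fintype.sum_sum_type, F.basisAt_apply, F.basisAt_repr, frame, coframe]

theorem smoothAt_X (hy : y ∈ F.U) (i : Fin d) : (F.X i).SmoothAt y :=
  (F.smooth_X i).contMDiffAt (F.isOpen_U.mem_nhds hy)

variable (y) in
theorem smoothAt_ZF (m : Fin h) : (F.ZF m).SmoothAt y :=
  (S.smooth_V _ (F.Z m).2).contMDiffAt univ_mem

theorem smoothAt_frame (hy : y ∈ F.U) (a : Fin d ⊕ Fin h) : (F.frame a).SmoothAt y := by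
  rcases a with i | m
  · exact F.smoothAt_X hy i
  · exact F.smoothAt_ZF y m

/-- The coframe is built from fibrewise inner products and the algebraic splitting, with no evident
smoothness. Identifying its values with coefficients in the smooth frame supplies it. -/
theorem contMDiffAt_coframe_apply (hy : y ∈ F.U) {Y : VField E M} (hY : Y.SmoothAt y)
    (a : Fin d ⊕ Fin h) :
    ContMDiffAt 𝓘(ℝ, E) 𝓘(ℝ, ℝ) ∞ (fun z => F.coframe a z (Y z)) y := by
  classical
  have hb0 (z : M) : Nonempty (Basis (Fin d ⊕ Fin h) ℝ (TangentSpace 𝓘(ℝ, E) z)) := by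
    have e : Fintype.card (Fin d ⊕ Fin h) = finrank ℝ (TangentSpace 𝓘(ℝ, E) z) := by
      rw [Fintype.card_sum, Fintype.card_fin, Fintype.card_fin]
      exact S.finrank_model.symm
    exact ⟨(finBasis ℝ (TangentSpace 𝓘(ℝ, E) z)).reindex
      (Fintype.equivOfCardEq (by rw [e, Fintype.card_fin]))⟩
  -- The basis outside `F.U` is arbitrary: only its germ at `y` matters.
  let b : (z : M) → Basis (Fin d ⊕ Fin h) ℝ (TangentSpace 𝓘(ℝ, E) z) := fun z =>
    if hz : z ∈ F.U then F.basisAt hz else (hb0 z).some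
  have hU := F.isOpen_U.mem_nhds hy
  have hb : ∀ᶠ z in 𝓝 y, ∀ a, b z a = F.frame a z := by
    filter_upwards [hU] with z hz a
    simp [b, hz, F.basisAt_apply]
  refine (hY.contMDiffAt_coeff b hb (F.smoothAt_frame hy) a).congr_of_eventuallyEq ?_
  filter_upwards [hU] with z hz
  simp [b, hz, F.basisAt_repr]

/-- The Christoffel symbols `½ (ω_ij^k + ω_ki^j + ω_kj^i)` of the canonical connection. -/
def christoffel (i j k : Fin d) (y : M) : ℝ :=
  1 / 2 * (F.bracketXX i j k y + F.bracketXX k i j y + F.bracketXX k j i y)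

theorem bracketXX_swap (i j k : Fin d) (y : M) :
    F.bracketXX i j k y = -F.bracketXX j i k y := by
  rw [bracketXX, bracketXX, VectorField.mlieBracket_swap_apply, map_neg]

/-- Skewness in the last two indices is metric compatibility of the connection on `H`. -/
theorem christoffel_swap (i j k : Fin d) (y : M) :
    F.christoffel i j k y = -F.christoffel i k j y := by
  simp only [christoffel]
  rw [F.bracketXX_swap k j i, F.bracketXX_swap i j k, F.bracketXX_swap i k j]
  ring

/-- This is the vanishing of the horizontal part of the torsion on `H`; it is what later turns
brackets into covariant derivatives in `dη`. -/
theorem christoffel_sub_swap (i j k : Fin d) (y : M) :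
    F.christoffel i j k y - F.christoffel j i k y = F.bracketXX i j k y := by
  simp only [christoffel]
  rw [F.bracketXX_swap j i k]
  ring

/-- `γ_ij^m`, the `Z_m`-component of `[X_i, X_j]`. -/
def bracketXXZ (i j : Fin d) (m : Fin h) (y : M) : ℝ :=
  F.ν m y (VectorField.mlieBracket 𝓘(ℝ, E) (F.X i) (F.X j) y)

theorem bracketXXZ_swap (i j : Fin d) (m : Fin h) (y : M) :
    F.bracketXXZ i j m y = -F.bracketXXZ j i m y := by
  rw [bracketXXZ, bracketXXZ, VectorField.mlieBracket_swap_apply, map_neg]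

theorem contMDiffAt_bracketXX (hy : y ∈ F.U) (i j k : Fin d) :
    ContMDiffAt 𝓘(ℝ, E) 𝓘(ℝ, ℝ) ∞ (F.bracketXX i j k) y := by
  refine F.contMDiffAt_coframe_apply hy (Y := VectorField.mlieBracket 𝓘(ℝ, E) (F.X i) (F.X j))
    ?_ (Sum.inl k)
  have : IsManifold 𝓘(ℝ, E) ((⊤ : ℕ∞) + 1) M := inferInstanceAs (IsManifold 𝓘(ℝ, E) ∞ M)
  have : IsManifold 𝓘(ℝ, E) (minSmoothness ℝ 2) M := by
    rw [minSmoothness_of_isRCLikeNormedField]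
    exact IsManifold.of_le (n := ∞) ENat.LEInfty.out
  exact ContMDiffAt.mlieBracket_vectorField (m := ⊤) (n := ⊤) (F.smoothAt_X hy i)
    (F.smoothAt_X hy j) (by simp)

theorem contMDiffAt_christoffel (hy : y ∈ F.U) (i j k : Fin d) :
    ContMDiffAt 𝓘(ℝ, E) 𝓘(ℝ, ℝ) ∞ (F.christoffel i j k) y :=
  contMDiffAt_const.mul (((F.contMDiffAt_bracketXX hy i j k).add
    (F.contMDiffAt_bracketXX hy k i j)).add (F.contMDiffAt_bracketXX hy k j i))

theorem conn_ZF (A : VField E M) (m : Fin h) : F.conn A (F.ZF m) y = 0 := by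
  have h0 : A.deriv (fun _ => 0) y = 0 := A.deriv_const 0 y
  have hν (l) : A.deriv (fun z => F.ν l z (F.ZF m z)) y = 0 := by
    simpa only [F.ν_ZF] using A.deriv_const _ y
  simp [conn, h0, hν, F.θ_ZF]

/-- The coframe components of `X_j` are constant on `F.U`, so their derivatives drop out; the `δ`
terms vanish because `A` is horizontal at `y`. -/
theorem conn_X (A : VField E M) (j : Fin d) (hy : y ∈ F.U) (hA : ∀ m, F.ν m y (A y) = 0) :
    F.conn A (F.X j) y =
      ∑ k, (∑ i, F.θ i y (A y) * F.christoffel i j k y) • F.X k y := by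
  have hU := F.isOpen_U.mem_nhds hy
  have hθ (k) : A.deriv (fun z => F.θ k z (F.X j z)) y = 0 := by
    rw [A.deriv_congr_of_eventuallyEq (g := fun _ => if j = k then 1 else 0), A.deriv_const]
    filter_upwards [hU] with z hz using F.θ_X hz k j
  have hν (l) : A.deriv (fun z => F.ν l z (F.X j z)) y = 0 := by
    rw [A.deriv_congr_of_eventuallyEq (g := fun _ => 0), A.deriv_const]
    filter_upwards [hU] with z hz using F.ν_X hz l j
  simp [conn, hθ, hν, hA, F.θ_X hy, christoffel]

theorem ν_conn_X (A : VField E M) (j : Fin d) (m : Fin h) (hy : y ∈ F.U)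
    (hA : ∀ m, F.ν m y (A y) = 0) : F.ν m y (F.conn A (F.X j) y) = 0 := by
  rw [F.conn_X A j hy hA]
  simp [F.ν_X hy]

theorem ν_torsion_X (i j : Fin d) (m : Fin h) (hy : y ∈ F.U) :
    F.ν m y (F.torsion (F.X i) (F.X j) y) = -F.bracketXXZ i j m y := by
  have h1 := F.ν_conn_X (F.X i) j m hy fun m => F.ν_X hy m i
  have h2 := F.ν_conn_X (F.X j) i m hy fun m => F.ν_X hy m j
  have e : F.torsion (F.X i) (F.X j) y = F.conn (F.X i) (F.X j) y - F.conn (F.X j) (F.X i) y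
    - VectorField.mlieBracket 𝓘(ℝ, E) (F.X i) (F.X j) y := rfl
  rw [e, map_sub, map_sub, h1, h2, bracketXXZ]
  simp

theorem coframe_sum_X (hy : y ∈ F.U) (a : Fin d → ℝ) (b : Fin h → ℝ) (j : Fin d) :
    (∑ i, a i • F.θ i y + ∑ m, b m • F.ν m y : TangentSpace 𝓘(ℝ, E) y →L[ℝ] ℝ) (F.X j y) = a j := by
  simp [F.θ_X hy, F.ν_X hy]

theorem coframe_sum_ZF (y : M) (a : Fin d → ℝ) (b : Fin h → ℝ) (l : Fin h) :
    (∑ i, a i • F.θ i y + ∑ m, b m • F.ν m y : TangentSpace 𝓘(ℝ, E) y →L[ℝ] ℝ) (F.ZF l y) = b l := by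
  simp [F.θ_ZF, F.ν_ZF]

theorem covForm_X (A : VField E M) (η : OneForm E M) (j : Fin d) (hy : y ∈ F.U)
    (hA : ∀ m, F.ν m y (A y) = 0) :
    F.covForm A η y (F.X j y) = A.deriv (fun z => η z (F.X j z)) y
      - ∑ k, (∑ i, F.θ i y (A y) * F.christoffel i j k y) * η y (F.X k y) := by
  rw [covForm, F.coframe_sum_X hy, F.conn_X A j hy hA]
  simp

theorem covForm_X_X (i j : Fin d) (η : OneForm E M) (hy : y ∈ F.U) :
    F.covForm (F.X i) η y (F.X j y) = (F.X i).deriv (fun z => η z (F.X j z)) y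
      - ∑ k, F.christoffel i j k y * η y (F.X k y) := by
  rw [F.covForm_X _ η j hy fun m => F.ν_X hy m i]
  simp [F.θ_X hy]

theorem covForm_ZF (A : VField E M) (η : OneForm E M) (m : Fin h) :
    F.covForm A η y (F.ZF m y) = A.deriv (fun z => η z (F.ZF m z)) y := by
  rw [covForm, F.coframe_sum_ZF, F.conn_ZF A m, map_zero, sub_zero]

/-- The components of a one-form in the frame are differentiable at a point. -/
def DiffComponents (η : OneForm E M) (y : M) : Prop :=
  ∀ a, MDifferentiableAt 𝓘(ℝ, E) 𝓘(ℝ, ℝ) (fun z => η z (F.frame a z)) y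

variable {F} in
theorem DiffComponents.X {η : OneForm E M} (hη : F.DiffComponents η y) (i : Fin d) :
    MDifferentiableAt 𝓘(ℝ, E) 𝓘(ℝ, ℝ) (fun z => η z (F.X i z)) y := hη (Sum.inl i)

variable {F} in
theorem DiffComponents.ZF {η : OneForm E M} (hη : F.DiffComponents η y) (m : Fin h) :
    MDifferentiableAt 𝓘(ℝ, E) 𝓘(ℝ, ℝ) (fun z => η z (F.ZF m z)) y := hη (Sum.inr m)

theorem diffComponents_of_smoothAt {η : OneForm E M} (hη : η.SmoothAt y) (hy : y ∈ F.U) :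
    F.DiffComponents η y := fun a =>
  (hη.apply (F.smoothAt_frame hy a)).mdifferentiableAt (by simp)

/-- Needed to apply metric compatibility a second time in the Bochner formula. -/
theorem diffComponents_covForm {η : OneForm E M} (hη : η.SmoothAt y) (hy : y ∈ F.U) (i : Fin d) :
    F.DiffComponents (F.covForm (F.X i) η) y := by
  have hU := F.isOpen_U.mem_nhds hy
  rintro (j | m)
  · have h1 : ContMDiffAt 𝓘(ℝ, E) 𝓘(ℝ, ℝ) ∞ (fun z => (F.X i).deriv (fun z => η z (F.X j z)) z
      - ∑ k, F.christoffel i j k z * η z (F.X k z)) y := by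
      refine ((F.smoothAt_X hy i).contMDiffAt_deriv (hη.apply (F.smoothAt_X hy j))).sub ?_
      exact contMDiffAt_finsetSum fun k _ =>
        (F.contMDiffAt_christoffel hy i j k).mul (hη.apply (F.smoothAt_X hy k))
    refine (h1.mdifferentiableAt (by simp)).congr_of_eventuallyEq ?_
    filter_upwards [hU] with z hz using F.covForm_X_X i j η hz
  · have h1 : ContMDiffAt 𝓘(ℝ, E) 𝓘(ℝ, ℝ) ∞ ((F.X i).deriv (fun z => η z (F.ZF m z))) y :=
      (F.smoothAt_X hy i).contMDiffAt_deriv (hη.apply (F.smoothAt_ZF y m))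
    refine (h1.mdifferentiableAt (by simp)).congr_of_eventuallyEq ?_
    exact Eventually.of_forall fun z => F.covForm_ZF _ η m

/-- The canonical connection is metric in horizontal directions. -/
theorem deriv_coInner (ε : ℝ) {η ζ : OneForm E M} (hη : F.DiffComponents η y)
    (hζ : F.DiffComponents ζ y) (hy : y ∈ F.U) (A : VField E M) (hA : ∀ m, F.ν m y (A y) = 0) :
    A.deriv (F.coInner ε η ζ) y =
      F.coInner ε (F.covForm A η) ζ y + F.coInner ε η (F.covForm A ζ) y := by
  have hX := A.mdifferentiableAt_and_deriv_sum Finset.univ fun i _ => (hη.X i).mul (hζ.X i)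
  have hZ := A.mdifferentiableAt_and_deriv_sum Finset.univ fun m _ => (hη.ZF m).mul (hζ.ZF m)
  have e : A.deriv (F.coInner ε η ζ) y =
      ∑ i, (η y (F.X i y) * A.deriv (fun z => ζ z (F.X i z)) y
        + A.deriv (fun z => η z (F.X i z)) y * ζ y (F.X i y))
      + ε * ∑ m, (η y (F.ZF m y) * A.deriv (fun z => ζ z (F.ZF m z)) y
        + A.deriv (fun z => η z (F.ZF m z)) y * ζ y (F.ZF m y)) := by
    refine (A.deriv_add hX.1 (mdifferentiableAt_const.mul hZ.1)).trans ?_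
    congr 1
    · exact hX.2.trans (Finset.sum_congr rfl fun i _ => A.deriv_mul (hη.X i) (hζ.X i))
    · refine (A.deriv_const_mul ε hZ.1).trans ?_
      congr 1
      exact hZ.2.trans (Finset.sum_congr rfl fun m _ => A.deriv_mul (hη.ZF m) (hζ.ZF m))
  -- The connection terms of the two pairings cancel after exchanging `i` and `k`, by skewness of
  -- the Christoffel symbols.
  have key : ∑ i, (∑ k, (∑ l, F.θ l y (A y) * F.christoffel l i k y) * η y (F.X k y)) * ζ y (F.X i y)
      + ∑ i, η y (F.X i y) * (∑ k, (∑ l, F.θ l y (A y) * F.christoffel l i k y) * ζ y (F.X k y)) = 0 := by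
    simp only [Finset.sum_mul, Finset.mul_sum]
    rw [Finset.sum_comm, ← Finset.sum_add_distrib]
    refine Finset.sum_eq_zero fun i _ => ?_
    rw [← Finset.sum_add_distrib]
    refine Finset.sum_eq_zero fun k _ => ?_
    rw [← Finset.sum_add_distrib]
    refine Finset.sum_eq_zero fun l _ => ?_
    rw [F.christoffel_swap l k i]
    ring
  rw [e]
  simp only [coInner, F.covForm_X A _ _ hy hA, F.covForm_ZF A _ _, sub_mul, mul_sub,
    Finset.sum_sub_distrib, Finset.sum_add_distrib, mul_add]
  linarith

theorem coInner_comm (ε : ℝ) (η ζ : OneForm E M) : F.coInner ε η ζ = F.coInner ε ζ η := by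
  ext y
  simp only [coInner, mul_comm]

theorem coInner_congr (ε : ℝ) {η η' ζ ζ' : OneForm E M} (h1 : η y = η' y) (h2 : ζ y = ζ' y) :
    F.coInner ε η ζ y = F.coInner ε η' ζ' y := by
  simp only [coInner, h1, h2]

theorem coInner_add_left (ε : ℝ) (η η' ζ : OneForm E M) :
    F.coInner ε (η + η') ζ y = F.coInner ε η ζ y + F.coInner ε η' ζ y := by
  simp only [coInner, Pi.add_apply, add_apply, add_mul, Finset.sum_add_distrib]
  ring

theorem coInner_smul_left (ε c : ℝ) (η ζ : OneForm E M) :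
    F.coInner ε (c • η) ζ y = c * F.coInner ε η ζ y := by
  simp only [coInner, Pi.smul_apply, smul_apply, smul_eq_mul, mul_assoc, ← Finset.mul_sum]
  ring

theorem coInner_sub_left (ε : ℝ) (η η' ζ : OneForm E M) :
    F.coInner ε (η - η') ζ y = F.coInner ε η ζ y - F.coInner ε η' ζ y := by
  rw [eq_sub_iff_add_eq, ← F.coInner_add_left, sub_add_cancel]

theorem coInner_sum_left (ε : ℝ) {ι : Type*} (s : Finset ι) (η : ι → OneForm E M)
    (ζ : OneForm E M) : F.coInner ε (∑ i ∈ s, η i) ζ y = ∑ i ∈ s, F.coInner ε (η i) ζ y := by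
  classical
  induction s using Finset.induction_on with
  | empty => simp [coInner]
  | insert i s his ih => rw [Finset.sum_insert his, Finset.sum_insert his, F.coInner_add_left, ih]

/-- The Bochner formula for the sub-Laplacian on one-forms. -/
theorem lapFun_coInner (ε : ℝ) {η : OneForm E M} (hη : ∀ z ∈ F.U, η.SmoothAt z) (hy : y ∈ F.U) :
    F.lapFun (F.coInner ε η η) y = 2 * F.coInner ε (F.lapForm η) η y
      + 2 * ∑ i, F.coInner ε (F.covForm (F.X i) η) (F.covForm (F.X i) η) y := by
  have hU := F.isOpen_U.mem_nhds hy
  -- Stated on all of `F.U`, so that the identity can be differentiated again at `y`.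
  have first (z) (hz : z ∈ F.U) (A : VField E M) (hA : ∀ m, F.ν m z (A z) = 0) :
      A.deriv (F.coInner ε η η) z = 2 * F.coInner ε (F.covForm A η) η z := by
    have hd := F.diffComponents_of_smoothAt (hη z hz) hz
    rw [F.deriv_coInner ε hd hd hz A hA, F.coInner_comm ε η]
    ring
  have second (i) : (F.X i).deriv ((F.X i).deriv (F.coInner ε η η)) y =
      2 * (F.coInner ε (F.covForm (F.X i) (F.covForm (F.X i) η)) η y
        + F.coInner ε (F.covForm (F.X i) η) (F.covForm (F.X i) η) y) := by
    have hd := F.diffComponents_of_smoothAt (hη y hy) hy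
    have hd' := F.diffComponents_covForm (hη y hy) hy i
    have hmd : MDifferentiableAt 𝓘(ℝ, E) 𝓘(ℝ, ℝ) (F.coInner ε (F.covForm (F.X i) η) η) y :=
      ((F.X i).mdifferentiableAt_and_deriv_sum Finset.univ
        fun i _ => (hd'.X i).mul (hd.X i)).1.add (mdifferentiableAt_const.mul
          ((F.X i).mdifferentiableAt_and_deriv_sum Finset.univ
            fun m _ => (hd'.ZF m).mul (hd.ZF m)).1)
    rw [(F.X i).deriv_congr_of_eventuallyEq
      (g := fun z => 2 * F.coInner ε (F.covForm (F.X i) η) η z), (F.X i).deriv_const_mul 2 hmd,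
      F.deriv_coInner ε hd' hd hy _ fun m => F.ν_X hy m i]
    filter_upwards [hU] with z hz using first z hz _ fun m => F.ν_X hz m i
  have e : F.lapForm η = ∑ i, (F.covForm (F.X i) (F.covForm (F.X i) η)
      - F.covForm (F.conn (F.X i) (F.X i)) η) := by
    ext1 z
    rw [Finset.sum_apply]
    rfl
  rw [e, F.coInner_sum_left, Finset.mul_sum, Finset.mul_sum, ← Finset.sum_add_distrib, lapFun]
  refine Finset.sum_congr rfl fun i _ => ?_
  rw [second, first y hy _ fun m => F.ν_conn_X (F.X i) i m hy fun m => F.ν_X hy m i,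
    F.coInner_sub_left]
  ring

end AdaptedFrame

end TransverseSymmetries

/-- Completing the squares in the Bochner quadratic form. -/
theorem bochner_quadratic_lower_bound {d h : ℕ} {ε : ℝ} (hε : 0 < ε) (Γ a : Fin d → Fin d → ℝ)
    (hΓ : ∀ i j, Γ i j = -Γ j i) (P q : Fin d → Fin h → ℝ) :
    ∑ i, ∑ j, (1 / 2 * Γ i j) ^ 2 + ε * ∑ i, ∑ m, (-(P i m) / ε) ^ 2
        + 2 * ∑ i, ∑ m, -(P i m) / ε * P i m ≤
      ∑ i, ∑ j, a i j ^ 2 + ε * ∑ i, ∑ m, q i m ^ 2 + 2 * ∑ i, ∑ m, q i m * P i m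
        - 1 / 2 * ∑ i, ∑ j, (a i j - a j i - Γ i j) * Γ i j := by
  -- Because `Γ` is skew, the `a j i` terms double the `a i j` terms.
  have h1 : ∑ i, ∑ j, (a i j - a j i - Γ i j) * Γ i j =
      2 * ∑ i, ∑ j, a i j * Γ i j - ∑ i, ∑ j, Γ i j ^ 2 := by
    have : ∑ i, ∑ j, a j i * Γ i j = -∑ i, ∑ j, a i j * Γ i j := by
      rw [Finset.sum_comm, ← Finset.sum_neg_distrib]
      refine Finset.sum_congr rfl fun i _ => ?_
      rw [← Finset.sum_neg_distrib]
      exact Finset.sum_congr rfl fun j _ => by rw [hΓ j i]; ring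
    simp only [sub_mul, Finset.sum_sub_distrib, this, ← pow_two]
    ring
  have h2 : 0 ≤ ∑ i, ∑ j, (a i j - 1 / 2 * Γ i j) ^ 2 :=
    Finset.sum_nonneg fun i _ => Finset.sum_nonneg fun j _ => sq_nonneg _
  have h3 : ∑ i, ∑ j, (a i j - 1 / 2 * Γ i j) ^ 2 =
      ∑ i, ∑ j, a i j ^ 2 - ∑ i, ∑ j, a i j * Γ i j + ∑ i, ∑ j, (1 / 2 * Γ i j) ^ 2 := by
    simp only [← Finset.sum_sub_distrib, ← Finset.sum_add_distrib]
    exact Finset.sum_congr rfl fun i _ => Finset.sum_congr rfl fun j _ => by ring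
  have h4 : ∑ i, ∑ j, (1 / 2 * Γ i j) ^ 2 = 1 / 4 * ∑ i, ∑ j, Γ i j ^ 2 := by
    simp only [Finset.mul_sum]
    exact Finset.sum_congr rfl fun i _ => Finset.sum_congr rfl fun j _ => by ring
  have h5 : ε * ∑ i, ∑ m, (-(P i m) / ε) ^ 2 + 2 * ∑ i, ∑ m, -(P i m) / ε * P i m ≤
      ε * ∑ i, ∑ m, q i m ^ 2 + 2 * ∑ i, ∑ m, q i m * P i m := by
    simp only [Finset.mul_sum, ← Finset.sum_add_distrib]
    refine Finset.sum_le_sum fun i _ => Finset.sum_le_sum fun m _ => ?_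
    -- The difference from the value at `q = -P/ε` is exactly a square.
    have h6 : ε * q i m ^ 2 + 2 * (q i m * P i m) - (ε * (-(P i m) / ε) ^ 2
        + 2 * (-(P i m) / ε * P i m)) = ε * (q i m + P i m / ε) ^ 2 := by
      field_simp
      ring
    have h7 : 0 ≤ ε * (q i m + P i m / ε) ^ 2 := by positivity
    linarith
  rw [h1]
  linarith

/-! ### The Bochner functional as a quadratic form, and its closed minimiser -/

namespace TransverseSymmetries

namespace AdaptedFrame

variable {E : Type*} [NormedAddCommGroup E] [NormedSpace ℝ E] [FiniteDimensional ℝ E]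
  {M : Type*} [TopologicalSpace M] [ChartedSpace E M] [IsManifold 𝓘(ℝ, E) ∞ M]
  {d h : ℕ} {S : TransverseSymmetries E M d h} {x₀ : M} (F : S.AdaptedFrame x₀) {y : M}

/-- The vertical part of `-η(T(X_i, X_j))`, namely `∑ₘ γ_ij^m η(Z_m)`. -/
def verticalBracket (η : OneForm E M) (i j : Fin d) (y : M) : ℝ :=
  ∑ m, F.bracketXXZ i j m y * η y (F.ZF m y)

/-- The contraction `∑ₖ γ_ik^m η(X_k)`. -/
def horizontalContraction (η : OneForm E M) (i : Fin d) (m : Fin h) (y : M) : ℝ :=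
  ∑ k, F.bracketXXZ i k m y * η y (F.X k y)

theorem verticalBracket_swap (η : OneForm E M) (i j : Fin d) (y : M) :
    F.verticalBracket η i j y = -F.verticalBracket η j i y := by
  simp only [verticalBracket, ← Finset.sum_neg_distrib]
  exact Finset.sum_congr rfl fun m _ => by rw [F.bracketXXZ_swap]; ring

theorem frakJ_X (η : OneForm E M) (k : Fin d) (hy : y ∈ F.U) :
    F.frakJ η y (F.X k y) =
      -∑ m, ∑ i, (F.X i).deriv (fun z => η z (F.ZF m z)) y * F.bracketXXZ i k m y := by
  simp only [frakJ, JForm, F.gVT_ZF_left, F.ν_torsion_X _ _ _ hy, sum_apply,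
    smul_apply, smul_eq_mul, F.θ_X hy, mul_ite, mul_one, mul_zero,
    Finset.sum_ite_eq, Finset.mem_univ, if_true, mul_neg, Finset.sum_neg_distrib]
  rfl

theorem frakJ_ZF (η : OneForm E M) (l : Fin h) : F.frakJ η y (F.ZF l y) = 0 := by
  simp [frakJ, JForm, sum_apply, F.θ_ZF]

theorem coInner_frakJ (ε : ℝ) (η : OneForm E M) (hy : y ∈ F.U) :
    F.coInner ε (F.frakJ η) η y = -∑ i, ∑ m, (F.X i).deriv (fun z => η z (F.ZF m z)) y *
      F.horizontalContraction η i m y := by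
  simp only [coInner, F.frakJ_X η _ hy, F.frakJ_ZF, zero_mul, Finset.sum_const_zero, mul_zero,
    add_zero, horizontalContraction, Finset.mul_sum, neg_mul, Finset.sum_neg_distrib, Finset.sum_mul]
  congr 1
  rw [Finset.sum_comm]
  conv_rhs => rw [Finset.sum_comm]
  refine Finset.sum_congr rfl fun m _ => ?_
  rw [Finset.sum_comm]
  exact Finset.sum_congr rfl fun i _ => Finset.sum_congr rfl fun k _ => by ring

/-- The vertical weight `ε` cancels the factor `1/ε`, and the minus sign cancels that of `T(X_i,
X_j)`, whose vertical components are `-γ_ij^m`. This is what singles out the coefficient `-1/ε`. -/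
theorem coInner_torsionDual {ε : ℝ} (hε : 0 < ε) (η : OneForm E M) (hy : y ∈ F.U) :
    F.coInner ε (fun z => (-(1 / ε) • F.torsionDual z) (η.extDerivAt z)) η y =
      1 / 2 * ∑ i, ∑ j, η.extDerivAt y ![F.X i y, F.X j y] * F.verticalBracket η i j y := by
  let τ : OneForm E M := fun z => F.torsionDual z (η.extDerivAt z)
  have e : (fun z => (-(1 / ε) • F.torsionDual z) (η.extDerivAt z)) = (-(1 / ε)) • τ := rfl
  have hX (k) : τ y (F.X k y) = 0 := by
    simp [τ, torsionDual, sum_apply, F.ν_X hy]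
  have hZ (l) : τ y (F.ZF l y) =
      -(1 / 2 * ∑ i, ∑ j, η.extDerivAt y ![F.X i y, F.X j y] * F.bracketXXZ i j l y) := by
    simp [τ, torsionDual, sum_apply, F.ν_ZF, F.gVT_ZF_right, F.ν_torsion_X _ _ _ hy]
  rw [e, F.coInner_smul_left]
  simp only [coInner, hX, hZ, zero_mul, Finset.sum_const_zero, zero_add, verticalBracket]
  have e2 : ∑ i, ∑ j, η.extDerivAt y ![F.X i y, F.X j y] *
        ∑ m, F.bracketXXZ i j m y * η y (F.ZF m y) =
      ∑ m, (∑ i, ∑ j, η.extDerivAt y ![F.X i y, F.X j y] * F.bracketXXZ i j m y)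
        * η y (F.ZF m y) := by
    simp only [Finset.mul_sum, Finset.sum_mul]
    conv_rhs => rw [Finset.sum_comm]
    refine Finset.sum_congr rfl fun i _ => ?_
    rw [Finset.sum_comm]
    exact Finset.sum_congr rfl fun m _ => Finset.sum_congr rfl fun j _ => by ring
  rw [e2]
  simp only [neg_mul, Finset.sum_neg_distrib, mul_assoc, ← Finset.mul_sum]
  field_simp

theorem coInner_covForm_X (ε : ℝ) (η : OneForm E M) :
    ∑ i, F.coInner ε (F.covForm (F.X i) η) (F.covForm (F.X i) η) y =
      ∑ i, ∑ j, (F.covForm (F.X i) η y (F.X j y)) ^ 2 +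
        ε * ∑ i, ∑ m, ((F.X i).deriv (fun z => η z (F.ZF m z)) y) ^ 2 := by
  simp only [coInner, F.covForm_ZF, Finset.sum_add_distrib, ← Finset.mul_sum, pow_two]

/-- The Bochner formula cancels `⟨Lη, η⟩`, hence all second derivatives of `η`. -/
theorem bochner_expansion (ε : ℝ) {η : OneForm E M} (hη : η.Smooth) (hy : y ∈ F.U)
    (Λ : (y : M) → TwoFormAt E M y →ₗ[ℝ] (TangentSpace 𝓘(ℝ, E) y →L[ℝ] ℝ)) :
    1 / 2 * F.lapFun (F.coInner ε η η) y - F.coInner ε (F.boxWith Λ η) η y =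
      ∑ i, ∑ j, (F.covForm (F.X i) η y (F.X j y)) ^ 2 +
        ε * ∑ i, ∑ m, ((F.X i).deriv (fun z => η z (F.ZF m z)) y) ^ 2 +
        2 * ∑ i, ∑ m, (F.X i).deriv (fun z => η z (F.ZF m z)) y * F.horizontalContraction η i m y +
        F.coInner ε (F.ricForm η) η y - F.coInner ε (fun z => Λ z (η.extDerivAt z)) η y := by
  have e : F.boxWith Λ η = F.lapForm η + (2 : ℝ) • F.frakJ η - F.ricForm η
      + fun z => Λ z (η.extDerivAt z) := rfl
  rw [F.lapFun_coInner ε (fun z _ => hη z) hy, F.coInner_covForm_X, e, F.coInner_add_left,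
    F.coInner_sub_left, F.coInner_add_left, F.coInner_smul_left, F.coInner_frakJ ε η hy]
  ring

/-- In Cartan's formula the horizontal part of `[X_i, X_j]` is absorbed by the antisymmetrised
Christoffel terms, leaving only the vertical part. -/
theorem extDerivAt_X_X {η : OneForm E M} (hη : η.SmoothAt y) (hy : y ∈ F.U) (i j : Fin d) :
    η.extDerivAt y ![F.X i y, F.X j y] = F.covForm (F.X i) η y (F.X j y)
      - F.covForm (F.X j) η y (F.X i y) - F.verticalBracket η i j y := by
  have hb : η y (VectorField.mlieBracket 𝓘(ℝ, E) (F.X i) (F.X j) y) =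
      ∑ k, (F.christoffel i j k y - F.christoffel j i k y) * η y (F.X k y)
        + F.verticalBracket η i j y := by
    conv_lhs => rw [F.eq_sum_frame hy (VectorField.mlieBracket 𝓘(ℝ, E) (F.X i) (F.X j) y)]
    simp only [map_add, map_sum, map_smul, smul_eq_mul, F.christoffel_sub_swap]
    rfl
  rw [OneForm.extDerivAt_apply hη (F.smoothAt_X hy i) (F.smoothAt_X hy j), hb,
    F.covForm_X_X i j η hy, F.covForm_X_X j i η hy]
  simp only [sub_mul, Finset.sum_sub_distrib]
  ring

/-- The first derivatives at `x₀` of the components of a one-form can be changed arbitrarily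
without changing its value. -/
theorem exists_smooth_oneForm_frame_deriv [T2Space M] (hy : y ∈ F.U) {η : OneForm E M}
    (hη : η.Smooth) (β : Fin d ⊕ Fin h → Fin d ⊕ Fin h → ℝ) :
    ∃ ζ : OneForm E M, ζ.Smooth ∧ ζ y = η y ∧ ∀ a b,
      (F.frame a).deriv (fun z => ζ z (F.frame b z)) y =
        (F.frame a).deriv (fun z => η z (F.frame b z)) y + β a b := by
  let B : TangentSpace 𝓘(ℝ, E) y →ₗ[ℝ] TangentSpace 𝓘(ℝ, E) y →ₗ[ℝ] ℝ :=
    (F.basisAt hy).constr ℝ fun a => (F.basisAt hy).constr ℝ (β a)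
  have hB (a b) : B (F.frame a y) (F.frame b y) = β a b := by
    rw [← F.basisAt_apply hy, ← F.basisAt_apply hy]
    simp only [B, Basis.constr_basis]
  obtain ⟨ξ, hξ, hξ0, hξd⟩ := exists_smooth_oneForm_deriv (E := E) y B
  refine ⟨η + ξ, fun z => OneForm.SmoothAt.add (hη z) (hξ z), ?_, fun a b => ?_⟩
  · rw [Pi.add_apply, hξ0, add_zero]
  · have hb := F.smoothAt_frame hy b
    have h1 := (OneForm.SmoothAt.apply (hη y) hb).mdifferentiableAt (n := ∞) (by simp)
    have h2 := (OneForm.SmoothAt.apply (hξ y) hb).mdifferentiableAt (n := ∞) (by simp)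
    refine ((F.frame a).deriv_add h1 h2).trans ?_
    rw [hξd _ _ hb]
    exact congrArg _ (hB a b)

theorem extDerivAt_frame_swap (η : OneForm E M) (a b : Fin d ⊕ Fin h) :
    η.extDerivAt y ![F.frame b y, F.frame a y] = -η.extDerivAt y ![F.frame a y, F.frame b y] := by
  have := (η.extDerivAt y).map_swap ![F.frame a y, F.frame b y] (i := 0) (j := 1) (by simp)
  refine Eq.trans (congrArg (η.extDerivAt y) ?_) this
  ext i
  fin_cases i <;> rfl

/-- Every value at a point is attained by a smooth one-form which is closed at that point and has
optimal horizontal derivatives there. -/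
theorem exists_optimal_oneForm [T2Space M] (hy : y ∈ F.U) (ε : ℝ) {η : OneForm E M}
    (hη : η.Smooth) : ∃ ζ : OneForm E M, ζ.Smooth ∧ ζ y = η y ∧ ζ.extDerivAt y = 0 ∧
      (∀ i j, F.covForm (F.X i) ζ y (F.X j y) = 1 / 2 * F.verticalBracket η i j y) ∧
      ∀ i m, (F.X i).deriv (fun z => ζ z (F.ZF m z)) y =
        -(F.horizontalContraction η i m y) / ε := by
  let δ : Fin d → Fin h → ℝ := fun i m => -(F.horizontalContraction η i m y) / ε
    - (F.X i).deriv (fun z => η z (F.ZF m z)) y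
  let D : Fin d ⊕ Fin h → Fin d ⊕ Fin h → ℝ := fun a b =>
    η.extDerivAt y ![F.frame a y, F.frame b y]
  have hD (a b) : D b a = -D a b := F.extDerivAt_frame_swap η a b
  -- Increments of the frame derivatives of `η`. The rows along `X_i` are forced by optimality; the
  -- `Z_m`-derivative of the `X_i`-component then cancels the mixed part of `dη`, and half of the
  -- vertical part is removed from each of its two antisymmetric slots.
  let β : Fin d ⊕ Fin h → Fin d ⊕ Fin h → ℝ := fun a b => match a, b with
    | .inl i, .inl j => 1 / 2 * F.verticalBracket η i j y - F.covForm (F.X i) η y (F.X j y)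
    | .inl i, .inr m => δ i m
    | .inr m, .inl i => δ i m + D (.inl i) (.inr m)
    | .inr l, .inr m => -(1 / 2) * D (.inr l) (.inr m)
  -- This is closedness of the corrected form at `y`, read on pairs of frame vectors.
  have hβ (a b) : D a b + β a b - β b a = 0 := by
    rcases a with i | l <;> rcases b with j | m <;> simp only [β]
    · have h1 : D (.inl i) (.inl j) = _ := F.extDerivAt_X_X (hη y) hy i j
      rw [h1, F.verticalBracket_swap η j i]
      ring
    · ring
    · rw [hD (.inl j)]
      ring
    · rw [hD (.inr l) (.inr m)]
      ring
  obtain ⟨ζ, hζ, hζy, hζd⟩ := F.exists_smooth_oneForm_frame_deriv hy hη β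
  refine ⟨ζ, hζ, hζy, ?_, fun i j => ?_, fun i m => ?_⟩
  · have hz (a b) : ζ.extDerivAt y ![F.frame a y, F.frame b y] = 0 := by
      have ha := F.smoothAt_frame hy a
      have hb := F.smoothAt_frame hy b
      have hDab : D a b = _ := OneForm.extDerivAt_apply (hη y) ha hb
      -- The bracket term depends only on the value at `y`, common to `ζ` and `η`, so `dζ - dη` is
      -- the antisymmetrisation of `β`.
      rw [OneForm.extDerivAt_apply (hζ y) ha hb, hζd, hζd, hζy]
      linarith [hβ a b]
    apply ContinuousAlternatingMap.toAlternatingMap_injective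
    refine Basis.ext_alternating (F.basisAt hy) fun v _ => ?_
    have e : (fun i => F.basisAt hy (v i)) = ![F.frame (v 0) y, F.frame (v 1) y] := by
      ext i
      fin_cases i <;> exact F.basisAt_apply hy _
    rw [e]
    exact hz _ _
  · have h1 := hζd (.inl i) (.inl j)
    simp only [β, frame, Sum.elim_inl, F.covForm_X_X i j η hy] at h1
    rw [F.covForm_X_X i j ζ hy, h1, hζy]
    ring
  · have h1 := hζd (.inl i) (.inr m)
    simp only [β, δ, frame, Sum.elim_inl, Sum.elim_inr] at h1
    rw [h1]
    ring

end AdaptedFrame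

end TransverseSymmetries

end

theorem mainTheorem11 {E : Type*} [NormedAddCommGroup E] [NormedSpace ℝ E] [FiniteDimensional ℝ E]
    {M : Type*} [TopologicalSpace M] [T2Space M] [ChartedSpace E M] [IsManifold 𝓘(ℝ, E) ∞ M]
    {d h : ℕ} (S : TransverseSymmetries E M d h) (ε : ℝ) (hε : 0 < ε)
    (Λ : (y : M) → TwoFormAt E M y →ₗ[ℝ] (TangentSpace 𝓘(ℝ, E) y →L[ℝ] ℝ))
    (x : M) (F : S.AdaptedFrame x) :
    F.bochnerInf ε Λ ≤ F.bochnerInf ε (fun y => -(1 / ε) • F.torsionDual y) := by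
  have hx := F.mem_U
  refine le_iInf fun η => le_iInf fun hη => le_iInf fun hη1 => ?_
  obtain ⟨ζ, hζ, hζx, hdζ, hζX, hζZ⟩ := F.exists_optimal_oneForm hx ε hη
  have hζ1 : F.coInner ε ζ ζ x = 1 := by rw [← hη1, F.coInner_congr ε hζx hζx]
  refine iInf_le_of_le ζ (iInf_le_of_le hζ (iInf_le_of_le hζ1 (EReal.coe_le_coe_iff.2 ?_)))
  rw [F.bochner_expansion ε hζ hx, F.bochner_expansion ε hη hx, F.coInner_torsionDual hε η hx]
  -- Fibrewise linearity of `Λ` enters here: `dζ` vanishes at `x`, hence so does its image.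
  have hΛ : F.coInner ε (fun z => Λ z (ζ.extDerivAt z)) ζ x = 0 := by
    simp [TransverseSymmetries.AdaptedFrame.coInner, hdζ]
  have hR : F.ricForm ζ x = F.ricForm η x := by
    simp only [TransverseSymmetries.AdaptedFrame.ricForm, hζx]
  have hP (i m) : F.horizontalContraction ζ i m x = F.horizontalContraction η i m x := by
    simp only [TransverseSymmetries.AdaptedFrame.horizontalContraction, hζx]
  rw [hΛ, F.coInner_congr ε hR hζx]
  simp only [hζX, hζZ, hP, F.extDerivAt_X_X (hη x) hx]
  linarith [bochner_quadratic_lower_bound hε (fun i j => F.verticalBracket η i j x)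
    (fun i j => F.covForm (F.X i) η x (F.X j x)) (fun i j => F.verticalBracket_swap η i j x)
    (fun i m => F.horizontalContraction η i m x)
    (fun i m => (F.X i).deriv (fun z => η z (F.ZF m z)) x)]
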